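/- Let $A$ be a noetherian commutative $\mathbb{C}$-algebra with the discrete topology; all topologies below are $A$-linear and "complete" includes "separated". Let $R$ be a $(\varphi)$-adic ring over $A$: a commutative $A$-algebra, complete for the $(\varphi)$-adic topology, where $\varphi\in R$ is neither invertible nor a zero divisor and $R/(\varphi)$ is finite and free over $A$. Let $K=R_\varphi$, with the images of the ideals $\varphi^nR$ ($n\ge 0$) as fundamental system of neighbourhoods of $0$. For a topological $A$-algebra $S$, the middle (resp. left, resp. right) topology on $S\otimes_A S$ has as fundamental system of neighbourhoods of $0$ the images of $I\otimes J$ (resp. $I\otimes S$, resp. $S\otimes J$), with $I,J\subset S$ open $A$-submodules; write $S\hat\otimes S$, $\widehat{S\otimes S}^1$, $\widehat{S\otimes S}^2$ for the respective completions. Write $z=z\otimes 1$ and $w=1\otimes z$. Let $z\in R$ be a global coordinate on $R$, that is, multiplication induces an isomorphism $(R\hat\otimes R)/(z-w)\simeq R$. Then $z-w$ is invertible in $\widehat{K\otimes K}^1$ and $\widehat{K\otimes K}^2$, and there is a unique continuous $A$-linear derivation $\partial$ of $K$ with $\partial z=1$. Let $U$ be an associative unital $A$-algebra ($A$ central) which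 is a complete topological algebra whose topology is generated by left ideals. A field is a continuous $A$-linear map $X:K\to U$; put $(\partial X)(g)=X(-\partial g)$. For fields $X,Y$ let $XY(f\otimes g)=X(f)Y(g)$, let $(YX\circ\sigma)(f\otimes g)=Y(g)X(f)$ and $[X,Y]=XY-YX\circ\sigma$. They are mutually local if $[X,Y]\big((z-w)^N t\big)=0$ for some $N\ge 0$ and all $t\in K\otimes_A K$. Since $XY$ and $YX\circ\sigma$ are continuous for the right and the left topology respectively, they extend to $\widehat{K\otimes K}^2$ and $\widehat{K\otimes K}^1$. For $n\in\mathbb{Z}$ the $n$-product is $$(X_{(n)}Y)(g)=(XY)\big((z-w)^n(1\otimes g)\big)-(YX\circ\sigma)\big((z-w)^n(1\otimes g)\big),\qquad g\in K,$$ where $(z-w)^n$ is taken in $\widehat{K\otimes K}^2$ in the first term and in $\widehat{K\otimes K}^1$ in the second. **Theorem.** Let $\mathcal{F}$ be a $\mathbb{C}$-linear space of fields which is closed (for all $X,Y\in\mathcal F$ and $n\in\mathbb{Z}$, $X_{(n)}Y$ and $\partial X$ are in $\mathcal F$) and consists of mutually local fields. Let $\mathbf{1}:K\to U$ be a field such that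 $\mathbf{1}(g)$ is central in $U$ for every $g\in K$, such that $\partial\mathbf{1}=0$, and such that $\mathbf{1}_{(-1)}X=X$ for all $X\in\mathcal{F}+\mathbb{C}\mathbf{1}$. Then $\mathcal{F}+\mathbb{C}\mathbf{1}$, endowed with the $n$-products (that is, with the state-field correspondence $\mathcal{Y}(X,x)Y=\sum_{n\in\mathbb{Z}}X_{(n)}Y\,x^{-n-1}$), with the translation operator $T=\partial$ and with the vacuum vector $\mathbf{1}$, is a vertex algebra over $\mathbb{C}$. -/

import Mathlib

open scoped TensorProduct Topology
open UniformSpace (Completion)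

/-! ### Topologies on the tensor square of a topological algebra -/

section TensorTopologies

/-- The three topologies on `S ⊗ S` in use: fundamental systems of neighbourhoods of `0` are
`I ⊗ J` (middle), `I ⊗ S` (left, or `1`-topology) and `S ⊗ J` (right, or `2`-topology), for
`I`, `J` open submodules of `S`. -/
inductive TensorTopology
  | middle
  | left
  | right

variable {A S : Type*} [CommRing A] [CommRing S] [Algebra A S]

/-- The image of `M ⊗ N` in `S ⊗ S`. -/
def tensorSubmodule (M N : Submodule A S) : Submodule A (S ⊗[A] S) :=
  LinearMap.range (TensorProduct.mapIncl M N)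

theorem tmul_mem_tensorSubmodule {M N : Submodule A S} {x y : S} (hx : x ∈ M) (hy : y ∈ N) :
    x ⊗ₜ[A] y ∈ tensorSubmodule M N :=
  ⟨(⟨x, hx⟩ : M) ⊗ₜ[A] (⟨y, hy⟩ : N), rfl⟩

theorem tensorSubmodule_le_iff {M N : Submodule A S} {P : Submodule A (S ⊗[A] S)} :
    tensorSubmodule M N ≤ P ↔ ∀ x ∈ M, ∀ y ∈ N, x ⊗ₜ[A] y ∈ P := by
  constructor
  · intro h x hx y hy
    exact h (tmul_mem_tensorSubmodule hx hy)
  · rintro h _ ⟨t, rfl⟩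
    induction t with
    | zero => simp
    | tmul x y => exact h _ x.2 _ y.2
    | add a b ha hb => rw [map_add]; exact P.add_mem ha hb

theorem tensorSubmodule_mono {M M' N N' : Submodule A S} (hM : M ≤ M') (hN : N ≤ N') :
    tensorSubmodule M N ≤ tensorSubmodule M' N' :=
  tensorSubmodule_le_iff.2 fun _ hx _ hy => tmul_mem_tensorSubmodule (hM hx) (hN hy)

variable [TopologicalSpace S]

/-- The submodules of the first factor that enter the basic neighbourhoods of `0`. -/
def TensorTopology.fst (τ : TensorTopology) (M : Submodule A S) : Prop :=
  match τ with
  | .middle => IsOpen (M : Set S)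
  | .left => IsOpen (M : Set S)
  | .right => M = ⊤

/-- The submodules of the second factor that enter the basic neighbourhoods of `0`. -/
def TensorTopology.snd (τ : TensorTopology) (N : Submodule A S) : Prop :=
  match τ with
  | .middle => IsOpen (N : Set S)
  | .left => N = ⊤
  | .right => IsOpen (N : Set S)

theorem exists_open_submodule_le [IsTopologicalRing S] [IsLinearTopology A S] {s : Set S}
    (hs : s ∈ 𝓝 (0 : S)) : ∃ M : Submodule A S, IsOpen (M : Set S) ∧ (M : Set S) ⊆ s := by
  obtain ⟨M, h1, h2⟩ := (IsLinearTopology.hasBasis_open_submodule A (M := S)).mem_iff.1 hs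
  exact ⟨M, h1, h2⟩

theorem exists_open_mul_mem [IsTopologicalRing S] [IsLinearTopology A S] {M : Submodule A S}
    (hM : IsOpen (M : Set S)) :
    ∃ M' : Submodule A S, IsOpen (M' : Set S) ∧ ∀ x ∈ M', ∀ y ∈ M', x * y ∈ M := by
  have h : (fun p : S × S => p.1 * p.2) ⁻¹' (M : Set S) ∈ 𝓝 ((0 : S), (0 : S)) :=
    continuous_mul.continuousAt.preimage_mem_nhds
      (by simpa using hM.mem_nhds M.zero_mem)
  rw [nhds_prod_eq, Filter.mem_prod_self_iff] at h
  obtain ⟨t, ht, hsub⟩ := h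
  obtain ⟨M', ho, hle⟩ := exists_open_submodule_le (A := A) ht
  exact ⟨M', ho, fun x hx y hy => hsub (Set.mk_mem_prod (hle hx) (hle hy))⟩

theorem exists_open_const_mul_mem [IsTopologicalRing S] [IsLinearTopology A S]
    {M : Submodule A S} (hM : IsOpen (M : Set S)) (s : S) :
    ∃ M' : Submodule A S, IsOpen (M' : Set S) ∧ ∀ x ∈ M', s * x ∈ M := by
  have h : (fun x : S => s * x) ⁻¹' (M : Set S) ∈ 𝓝 (0 : S) :=
    (continuous_const_mul s).continuousAt.preimage_mem_nhds
      (by simpa using hM.mem_nhds M.zero_mem)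
  obtain ⟨M', ho, hle⟩ := exists_open_submodule_le (A := A) h
  exact ⟨M', ho, fun x hx => hle hx⟩

namespace TensorTopology

theorem fst_top (τ : TensorTopology) : τ.fst (⊤ : Submodule A S) := by
  cases τ <;> simp [fst]

theorem snd_top (τ : TensorTopology) : τ.snd (⊤ : Submodule A S) := by
  cases τ <;> simp [snd]

theorem fst_inf {τ : TensorTopology} {M M' : Submodule A S} (h : τ.fst M) (h' : τ.fst M') :
    τ.fst (M ⊓ M') := by
  cases τ <;> simp only [fst, Submodule.coe_inf] at *
  · exact h.inter h'
  · exact h.inter h'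
  · simp [h, h']

theorem snd_inf {τ : TensorTopology} {M M' : Submodule A S} (h : τ.snd M) (h' : τ.snd M') :
    τ.snd (M ⊓ M') := by
  cases τ <;> simp only [snd, Submodule.coe_inf] at *
  · exact h.inter h'
  · simp [h, h']
  · exact h.inter h'

variable [IsTopologicalRing S] [IsLinearTopology A S]

theorem fst_mul {τ : TensorTopology} {M : Submodule A S} (h : τ.fst M) :
    ∃ M' : Submodule A S, τ.fst M' ∧ ∀ x ∈ M', ∀ y ∈ M', x * y ∈ M := by
  cases τ <;> simp only [fst] at *
  · exact exists_open_mul_mem h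
  · exact exists_open_mul_mem h
  · exact ⟨⊤, rfl, by simp [h]⟩

theorem snd_mul {τ : TensorTopology} {M : Submodule A S} (h : τ.snd M) :
    ∃ M' : Submodule A S, τ.snd M' ∧ ∀ x ∈ M', ∀ y ∈ M', x * y ∈ M := by
  cases τ <;> simp only [snd] at *
  · exact exists_open_mul_mem h
  · exact ⟨⊤, rfl, by simp [h]⟩
  · exact exists_open_mul_mem h

theorem fst_const_mul {τ : TensorTopology} {M : Submodule A S} (h : τ.fst M) (s : S) :
    ∃ M' : Submodule A S, τ.fst M' ∧ ∀ x ∈ M', s * x ∈ M := by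
  cases τ <;> simp only [fst] at *
  · exact exists_open_const_mul_mem h s
  · exact exists_open_const_mul_mem h s
  · exact ⟨⊤, rfl, by simp [h]⟩

theorem snd_const_mul {τ : TensorTopology} {M : Submodule A S} (h : τ.snd M) (s : S) :
    ∃ M' : Submodule A S, τ.snd M' ∧ ∀ x ∈ M', s * x ∈ M := by
  cases τ <;> simp only [snd] at *
  · exact exists_open_const_mul_mem h s
  · exact ⟨⊤, rfl, by simp [h]⟩
  · exact exists_open_const_mul_mem h s

end TensorTopology

variable (A S) in
/-- The index set of the fundamental system of neighbourhoods of `0` for the topology `τ`. -/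
abbrev TensorIndex (τ : TensorTopology) : Type _ :=
  {p : Submodule A S × Submodule A S // τ.fst p.1 ∧ τ.snd p.2}

instance (τ : TensorTopology) : Nonempty (TensorIndex A S τ) :=
  ⟨⟨(⊤, ⊤), τ.fst_top, τ.snd_top⟩⟩

variable (A S) in
theorem tensor_ringSubgroupsBasis [IsTopologicalRing S] [IsLinearTopology A S]
    (τ : TensorTopology) :
    RingSubgroupsBasis (fun p : TensorIndex A S τ =>
      (tensorSubmodule p.1.1 p.1.2).toAddSubgroup) := by
  refine RingSubgroupsBasis.of_comm _ ?_ ?_ ?_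
  · rintro ⟨⟨M, N⟩, hM, hN⟩ ⟨⟨M', N'⟩, hM', hN'⟩
    refine ⟨⟨(M ⊓ M', N ⊓ N'), TensorTopology.fst_inf hM hM', TensorTopology.snd_inf hN hN'⟩, ?_⟩
    exact le_inf (tensorSubmodule_mono (A := A) inf_le_left inf_le_left)
      (tensorSubmodule_mono (A := A) inf_le_right inf_le_right)
  · rintro ⟨⟨M, N⟩, hM, hN⟩
    obtain ⟨M', hM', hMM⟩ := TensorTopology.fst_mul hM
    obtain ⟨N', hN', hNN⟩ := TensorTopology.snd_mul hN
    refine ⟨⟨(M', N'), hM', hN'⟩, ?_⟩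
    rintro _ ⟨s, hs, t, ht, rfl⟩
    have key : tensorSubmodule M' N' ≤
        (tensorSubmodule M N).comap (LinearMap.mulRight A t) := by
      refine tensorSubmodule_le_iff.2 fun x hx y hy => ?_
      have key2 : tensorSubmodule M' N' ≤
          (tensorSubmodule M N).comap (LinearMap.mulLeft A (x ⊗ₜ[A] y)) := by
        refine tensorSubmodule_le_iff.2 fun x' hx' y' hy' => ?_
        simp only [Submodule.mem_comap, LinearMap.mulLeft_apply,
          Algebra.TensorProduct.tmul_mul_tmul]
        exact tmul_mem_tensorSubmodule (hMM _ hx _ hx') (hNN _ hy _ hy')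
      exact key2 ht
    exact key hs
  · rintro s ⟨⟨M, N⟩, hM, hN⟩
    induction s with
    | zero =>
      refine ⟨⟨(M, N), hM, hN⟩, fun y _ => ?_⟩
      simp
    | tmul a b =>
      obtain ⟨M', hM', hMM⟩ := TensorTopology.fst_const_mul hM a
      obtain ⟨N', hN', hNN⟩ := TensorTopology.snd_const_mul hN b
      refine ⟨⟨(M', N'), hM', hN'⟩, ?_⟩
      have key : tensorSubmodule M' N' ≤
          (tensorSubmodule M N).comap (LinearMap.mulLeft A (a ⊗ₜ[A] b)) := by
        refine tensorSubmodule_le_iff.2 fun x hx y hy => ?_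
        simp only [Submodule.mem_comap, LinearMap.mulLeft_apply,
          Algebra.TensorProduct.tmul_mul_tmul]
        exact tmul_mem_tensorSubmodule (hMM _ hx) (hNN _ hy)
      exact fun y hy => key hy
    | add s t ihs iht =>
      obtain ⟨⟨⟨M₁, N₁⟩, hM₁, hN₁⟩, h₁⟩ := ihs
      obtain ⟨⟨⟨M₂, N₂⟩, hM₂, hN₂⟩, h₂⟩ := iht
      refine ⟨⟨(M₁ ⊓ M₂, N₁ ⊓ N₂), TensorTopology.fst_inf hM₁ hM₂,
        TensorTopology.snd_inf hN₁ hN₂⟩, fun y hy => ?_⟩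
      have e₁ := h₁ (tensorSubmodule_mono (A := A) inf_le_left inf_le_left hy)
      have e₂ := h₂ (tensorSubmodule_mono (A := A) inf_le_right inf_le_right hy)
      have : (s + t) * y = s * y + t * y := add_mul s t y
      simp only [Set.mem_preimage, this]
      exact Submodule.add_mem _ e₁ e₂

variable (A S) in
/-- The ring `S ⊗ S` endowed with the topology `τ`. -/
def TopTensor (_τ : TensorTopology) : Type _ := S ⊗[A] S

variable (τ : TensorTopology)

noncomputable instance : CommRing (TopTensor A S τ) :=
  inferInstanceAs (CommRing (S ⊗[A] S))

noncomputable instance : Algebra A (TopTensor A S τ) :=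
  inferInstanceAs (Algebra A (S ⊗[A] S))

/-- The pure tensor `f ⊗ g`. -/
def TopTensor.tmul (f g : S) : TopTensor A S τ := (f ⊗ₜ[A] g : S ⊗[A] S)

variable [IsTopologicalRing S] [IsLinearTopology A S]

noncomputable instance : TopologicalSpace (TopTensor A S τ) :=
  (tensor_ringSubgroupsBasis A S τ).topology

instance : IsTopologicalRing (TopTensor A S τ) :=
  (tensor_ringSubgroupsBasis A S τ).toRingFilterBasis.isTopologicalRing

noncomputable instance : UniformSpace (TopTensor A S τ) :=
  IsTopologicalAddGroup.rightUniformSpace (TopTensor A S τ)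

instance : IsUniformAddGroup (TopTensor A S τ) :=
  isUniformAddGroup_of_addCommGroup

theorem TopTensor.hasBasis_nhds_zero :
    (𝓝 (0 : TopTensor A S τ)).HasBasis (fun _ : TensorIndex A S τ => True)
      (fun p => {t : TopTensor A S τ | t ∈ tensorSubmodule p.1.1 p.1.2}) :=
  (tensor_ringSubgroupsBasis A S τ).hasBasis_nhds_zero

end TensorTopologies

/-! ### `(φ)`-adic rings, their localizations, global coordinates -/

section PhiAdic

/-- The complete (separated) topological ring `R` is a `(φ)`-adic ring over `A`: its topology is
the `(φ)`-adic one, `φ` is neither invertible nor a zero divisor, and `R / (φ)` is finite free over `A`. -/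
structure IsPhiAdicRing (A : Type*) {R : Type*} [CommRing A] [CommRing R] [Algebra A R]
    [UniformSpace R] [IsUniformAddGroup R] [IsTopologicalRing R]
    [CompleteSpace R] [T2Space R] (φ : R) : Prop where
  isAdic : IsAdic (Ideal.span {φ})
  not_isUnit : ¬ IsUnit φ
  mem_nonZeroDivisors : φ ∈ nonZeroDivisors R
  finite : Module.Finite A (R ⧸ Ideal.span {φ})
  free : Module.Free A (R ⧸ Ideal.span {φ})

/-- `K` is the localization `R_φ`, with the images of the ideals `φ ^ n R` as a fundamental system
of neighbourhoods of `0`. -/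
structure IsPhiLocalization {R : Type*} (K : Type*) [CommRing R] [CommRing K] [Algebra R K]
    [TopologicalSpace K] (φ : R) : Prop where
  away : IsLocalization.Away φ K
  hasBasis : (𝓝 (0 : K)).HasBasis (fun _ : ℕ => True)
    (fun n => algebraMap R K '' (Ideal.span {φ ^ n} : Ideal R))

section Coordinate

variable (A : Type*) {S : Type*} [CommRing A] [CommRing S] [Algebra A S]

/-- The element `z - w = z ⊗ 1 - 1 ⊗ z`. -/
noncomputable def coordDiff (τ : TensorTopology) (z : S) : TopTensor A S τ :=
  TopTensor.tmul τ z 1 - TopTensor.tmul τ 1 z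

variable (S) in
/-- The multiplication morphism `S ⊗ S → S`. -/
noncomputable def mulTensor : TopTensor A S .middle →+* S :=
  (Algebra.TensorProduct.lmul' A (S := S)).toRingHom

variable [UniformSpace S] [IsUniformAddGroup S] [IsTopologicalRing S] [IsLinearTopology A S]

theorem continuous_mulTensor : Continuous (mulTensor A S) := by
  refine continuous_of_continuousAt_zero (mulTensor A S) ?_
  rw [ContinuousAt, map_zero]
  intro s hs
  rw [Filter.mem_map]
  obtain ⟨M, hM, hMs⟩ := exists_open_submodule_le (A := A) hs
  obtain ⟨M', hM', hmul⟩ := exists_open_mul_mem hM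
  refine Filter.mem_of_superset ((TopTensor.hasBasis_nhds_zero (A := A) .middle).mem_of_mem
    (i := ⟨(M', M'), hM', hM'⟩) trivial) ?_
  have key : tensorSubmodule M' M' ≤
      M.comap (Algebra.TensorProduct.lmul' A (S := S)).toLinearMap :=
    tensorSubmodule_le_iff.2 fun x hx y hy => by
      simpa using hmul x hx y hy
  exact fun t ht => hMs (key ht)

/-- `z` is a global coordinate on the complete topological ring `S`: the kernel of the (surjective)
multiplication morphism from the completion of `S ⊗ S` for the middle topology to `S` is generated
by `z - w`, in other words multiplication induces an isomorphism of the quotient by `(z - w)`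
with `S`. -/
def IsGlobalCoordinate [CompleteSpace S] [T2Space S] (z : S) : Prop :=
  RingHom.ker (Completion.extensionHom (mulTensor A S) (continuous_mulTensor A)) =
    Ideal.span {((coordDiff A .middle z : TopTensor A S .middle) :
      Completion (TopTensor A S .middle))}

end Coordinate

section Derivation

variable (A : Type*) {K : Type*} [CommRing A] [CommRing K] [Algebra A K] [TopologicalSpace K]

open Classical in
/-- The derivation `∂ = ∂_z`: the continuous `A`-linear derivation of `K` with `∂ z = 1`. -/
noncomputable def coordDeriv (z : K) : Derivation A K K :=
  if h : ∃ d : Derivation A K K, Continuous d ∧ d z = 1 then h.choose else 0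

theorem continuous_coordDeriv (z : K) : Continuous (coordDeriv A z) := by
  unfold coordDeriv
  split_ifs with h
  · exact h.choose_spec.1
  · exact continuous_zero

end Derivation

end PhiAdic

/-! ### Distributions, fields, `n`-products -/

section Fields

variable {A K U : Type*} [CommRing A] [CommRing K] [Algebra A K] [Ring U] [Algebra A U]

/-- The `2`-distribution `XY : f ⊗ g ↦ X(f) Y(g)`. -/
noncomputable def prodDist (X Y : K →ₗ[A] U) : K ⊗[A] K →ₗ[A] U :=
  LinearMap.mul' A U ∘ₗ TensorProduct.map X Y

/-- The `2`-distribution `YX ∘ σ : f ⊗ g ↦ Y(g) X(f)`. -/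
noncomputable def prodDistSwap (X Y : K →ₗ[A] U) : K ⊗[A] K →ₗ[A] U :=
  prodDist Y X ∘ₗ (TensorProduct.comm A K K).toLinearMap

/-- The `2`-distribution `[X, Y] = XY - YX ∘ σ`. -/
noncomputable def bracketDist (X Y : K →ₗ[A] U) : K ⊗[A] K →ₗ[A] U :=
  prodDist X Y - prodDistSwap X Y

/-- `X` and `Y` are mutually local: `(z - w) ^ N [X, Y] = 0` for some `N`, where `K ⊗ K` acts on
`2`-distributions by `(d Z)(t) = Z(d t)`. -/
def MutuallyLocal (z : K) (X Y : K →ₗ[A] U) : Prop :=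
  ∃ N : ℕ, ∀ t : K ⊗[A] K, bracketDist X Y ((z ⊗ₜ[A] 1 - 1 ⊗ₜ[A] z) ^ N * t) = 0

variable [TopologicalSpace K] [IsTopologicalRing K] [IsLinearTopology A K]

section ZPow

variable (A)

/-- The power `(z - w) ^ n`, `n ∈ ℤ`, in the completion of `K ⊗ K` for the topology `τ`. It is used
for the left and the right topology, for which `z - w` is invertible. -/
noncomputable def coordDiffZPow (τ : TensorTopology) (z : K) : ℤ → Completion (TopTensor A K τ)
  | .ofNat n => (coordDiff A τ z : Completion (TopTensor A K τ)) ^ n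
  | .negSucc n => Ring.inverse (coordDiff A τ z : Completion (TopTensor A K τ)) ^ (n + 1)

end ZPow

section Extension

/-- An `A`-linear map `K ⊗ K → U`, seen as an additive map on `K ⊗ K` with the topology `τ`. -/
def distHom (τ : TensorTopology) (Z : K ⊗[A] K →ₗ[A] U) : TopTensor A K τ →+ U :=
  Z.toAddMonoidHom

theorem exists_open_left_ideal_le [TopologicalSpace U] [IsTopologicalRing U] [IsLinearTopology U U] {s : Set U} (hs : s ∈ 𝓝 (0 : U)) :
    ∃ J : Ideal U, IsOpen (J : Set U) ∧ (J : Set U) ⊆ s := by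
  obtain ⟨M, h1, h2⟩ := (IsLinearTopology.hasBasis_open_submodule U (M := U)).mem_iff.1 hs
  exact ⟨M, h1, h2⟩

theorem exists_open_submodule_map_mem [TopologicalSpace U] {X : K →ₗ[A] U} (hX : Continuous X)
    {J : Ideal U} (hJ : IsOpen (J : Set U)) :
    ∃ M : Submodule A K, IsOpen (M : Set K) ∧ ∀ x ∈ M, X x ∈ J := by
  have h : X ⁻¹' (J : Set U) ∈ 𝓝 (0 : K) :=
    hX.continuousAt.preimage_mem_nhds (by simpa using hJ.mem_nhds J.zero_mem)
  obtain ⟨M, hM, hle⟩ := exists_open_submodule_le (A := A) h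
  exact ⟨M, hM, fun x hx => hle hx⟩

variable [UniformSpace U] [IsUniformAddGroup U] [IsTopologicalRing U]

theorem continuous_distHom_prodDist [IsLinearTopology U U] (X : K →ₗ[A] U) {Y : K →ₗ[A] U}
    (hY : Continuous Y) : Continuous (distHom .right (prodDist X Y)) := by
  refine continuous_of_continuousAt_zero _ ?_
  rw [ContinuousAt, map_zero]
  intro s hs
  rw [Filter.mem_map]
  obtain ⟨J, hJ, hJs⟩ := exists_open_left_ideal_le hs
  obtain ⟨N, hN, hNJ⟩ := exists_open_submodule_map_mem hY hJ
  refine Filter.mem_of_superset ((TopTensor.hasBasis_nhds_zero (A := A) (S := K) .right).mem_of_mem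
    (i := ⟨(⊤, N), rfl, hN⟩) trivial) ?_
  have key : tensorSubmodule ⊤ N ≤ (J.restrictScalars A).comap (prodDist X Y) :=
    tensorSubmodule_le_iff.2 fun x _ y hy => by
      simpa [prodDist] using J.mul_mem_left (X x) (hNJ y hy)
  exact fun t ht => hJs (key ht)

theorem continuous_distHom_prodDistSwap [IsLinearTopology U U] {X : K →ₗ[A] U}
    (hX : Continuous X) (Y : K →ₗ[A] U) : Continuous (distHom .left (prodDistSwap X Y)) := by
  refine continuous_of_continuousAt_zero _ ?_
  rw [ContinuousAt, map_zero]
  intro s hs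
  rw [Filter.mem_map]
  obtain ⟨J, hJ, hJs⟩ := exists_open_left_ideal_le hs
  obtain ⟨M, hM, hMJ⟩ := exists_open_submodule_map_mem hX hJ
  refine Filter.mem_of_superset ((TopTensor.hasBasis_nhds_zero (A := A) (S := K) .left).mem_of_mem
    (i := ⟨(M, ⊤), hM, rfl⟩) trivial) ?_
  have key : tensorSubmodule M ⊤ ≤ (J.restrictScalars A).comap (prodDistSwap X Y) :=
    tensorSubmodule_le_iff.2 fun x hx y _ => by
      simpa [prodDistSwap, prodDist] using J.mul_mem_left (Y y) (hMJ x hx)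
  exact fun t ht => hJs (key ht)

theorem extension_smul [CompleteSpace U] [T2Space U] (τ : TensorTopology)
    {Z : K ⊗[A] K →ₗ[A] U} (hZ : Continuous (distHom τ Z)) (a : A)
    (x : Completion (TopTensor A K τ)) :
    (distHom τ Z).extension hZ ((algebraMap A (TopTensor A K τ) a : TopTensor A K τ) * x) =
      a • (distHom τ Z).extension hZ x := by
  induction x using Completion.induction_on with
  | hp =>
    refine isClosed_eq ?_ ?_
    · exact ((distHom τ Z).continuous_extension hZ).comp (continuous_const_mul _)
    · exact ((distHom τ Z).continuous_extension hZ).const_smul a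
  | ih t =>
    rw [← Completion.coe_mul, AddMonoidHom.extension_coe, AddMonoidHom.extension_coe,
      ← Algebra.smul_def]
    exact map_smul Z a _

end Extension

variable [UniformSpace U] [IsUniformAddGroup U] [IsTopologicalRing U]
  [CompleteSpace U] [T2Space U] [IsLinearTopology U U]

/-- The distribution `g ↦ ((z - w) ^ n Z)(1 ⊗ g)`, the restriction of `(z - w) ^ n Z`, where `Z` is
extended to the completion of `K ⊗ K` for the topology `τ`. -/
noncomputable def resDist (τ : TensorTopology) (z : K) (n : ℤ) (Z : K ⊗[A] K →ₗ[A] U)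
    (hZ : Continuous (distHom τ Z)) : K →ₗ[A] U where
  toFun g := (distHom τ Z).extension hZ
    (coordDiffZPow A τ z n * (TopTensor.tmul τ 1 g : TopTensor A K τ))
  map_add' f g := by
    have : TopTensor.tmul (A := A) τ 1 (f + g) =
        TopTensor.tmul τ (1 : K) f + TopTensor.tmul τ 1 g := TensorProduct.tmul_add _ _ _
    rw [this, Completion.coe_add, mul_add, map_add]
  map_smul' a g := by
    have : TopTensor.tmul (A := A) τ 1 (a • g) =
        algebraMap A (TopTensor A K τ) a * TopTensor.tmul τ (1 : K) g := by
      rw [← Algebra.smul_def]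
      exact TensorProduct.tmul_smul _ _ _
    rw [this, Completion.coe_mul, mul_left_comm, extension_smul, RingHom.id_apply]

/-- The `n`-product `X_(n) Y` of two fields, as a distribution: the restriction of
`(z - w) ^ n XY - (z - w) ^ n YX ∘ σ`, the first power being taken in the completion of `K ⊗ K` for
the right topology, the second one in the completion for the left topology. -/
noncomputable def nProduct (z : K) (n : ℤ) (X Y : K →L[A] U) : K →ₗ[A] U :=
  resDist .right z n (prodDist X.toLinearMap Y.toLinearMap)
      (continuous_distHom_prodDist X.toLinearMap Y.continuous) -
    resDist .left z n (prodDistSwap X.toLinearMap Y.toLinearMap)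
      (continuous_distHom_prodDistSwap X.continuous Y.toLinearMap)

/-- The derivative of a field, `(∂ X)(g) = X(- ∂ g)`. -/
noncomputable def fieldDeriv (z : K) (X : K →L[A] U) : K →L[A] U :=
  -(X.comp ⟨(coordDeriv A z : K →ₗ[A] K), continuous_coordDeriv A z⟩)

/-- A subspace of the space of fields is closed if it contains the `n`-products and the
derivatives of its elements. -/
def IsClosedSpace [Algebra ℂ U] [SMulCommClass A ℂ U] (z : K)
    (F : Submodule ℂ (K →L[A] U)) : Prop :=
  (∀ X ∈ F, ∀ Y ∈ F, ∀ n : ℤ, ∃ Z ∈ F, Z.toLinearMap = nProduct z n X Y) ∧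
    ∀ X ∈ F, fieldDeriv z X ∈ F

end Fields

/-! ### Vertex algebras -/

section VertexAlgebra

/-- Multiplication by `x - y` on formal distributions `∑ Φ m n x ^ (-m-1) y ^ (-n-1)`. -/
def mulXSubY {M : Type*} [AddCommGroup M] (Φ : ℤ → ℤ → M) : ℤ → ℤ → M :=
  fun m n => Φ (m + 1) n - Φ m (n + 1)

/-- A structure of vertex algebra on the complex vector space `V`: a vacuum vector, a translation
operator `T` and a state-field correspondence `Y(a, x) = ∑ a_(n) x ^ (-n-1)`, where
`a_(n) = (Y a).ncoeff n`, satisfying the vacuum, translation and locality axioms. -/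
structure VertexAlgebraStructure (V : Type*) [AddCommGroup V] [Module ℂ V] where
  vacuum : V
  T : V →ₗ[ℂ] V
  Y : V →ₗ[ℂ] VertexOperator ℂ V
  /-- `Y(vacuum, x) = id`. -/
  vacuum_left : ∀ (n : ℤ) (a : V),
    (Y vacuum).ncoeff n a = if n = -1 then a else 0
  /-- `Y(a, x) vacuum` is a power series with constant term `a`. -/
  vacuum_right_nonneg : ∀ (a : V) (n : ℤ), 0 ≤ n → (Y a).ncoeff n vacuum = 0
  vacuum_right : ∀ a : V, (Y a).ncoeff (-1) vacuum = a
  T_vacuum : T vacuum = 0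
  /-- `[T, Y(a, x)] = ∂_x Y(a, x)`. -/
  translation : ∀ (a b : V) (n : ℤ),
    T ((Y a).ncoeff n b) - (Y a).ncoeff n (T b) = (-n : ℂ) • (Y a).ncoeff (n - 1) b
  /-- `(x - y) ^ N [Y(a, x), Y(b, y)] = 0` for some `N`. -/
  locality : ∀ a b : V, ∃ N : ℕ,
    mulXSubY^[N] (fun m n => ⁅(Y a).ncoeff m, (Y b).ncoeff n⁆) = 0

end VertexAlgebra

/-!
Write `d = z - w`. The proof rests on four facts about `K ⊗ K`.

*The coordinate.* As `z` is a global coordinate, `g ⊗ 1 - 1 ⊗ g` lies in the closure of the ideal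
`(d)` of `R ⊗ R` for every `g` (`tmul_sub_tmul_mem_closure_span`). Hence `A[z] → R / (φ ^ n)` is an
epimorphism of rings; being finite it is surjective (`aeval_surjective_of_tmul_sub_tmul_mem_span`),
and `A[z]` is dense in `R`. Since `R / (φ)` is finite and free, `φ` is a unit multiple of `P(z)`,
with `P` the characteristic polynomial of `z` on `R / (φ)`, and `φ ^ n ∣ f(z)` implies `P ^ n ∣ f`
(`exists_associated_aeval_dvd`, `pow_dvd_of_aeval_mem_span_pow`).

*Invertibility of `d`.* The element `d` divides `P(z) - P(w)`, which is `- P(w) (1 - P(z) / P(w))`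
or `P(z) (1 - P(w) / P(z))`. In the left, respectively right, completion of `K ⊗ K` the geometric
series converges, so `d` is a unit (`isUnit_coordDiff_left`, `isUnit_coordDiff_right`).

*The derivation.* If `φ ^ (n + 1)` divides `f(z)`, then `P ^ (n + 1)` divides `f`, and `φ ^ n`
divides `f'(z)`. So `d / dz` is continuous on `A[z]` and extends to `R`, then to `K`
(`IsPhiAdicRing.exists_derivation`, `IsPhiLocalization.exists_derivation`).

*The diagonal.* The property that `g ⊗ 1 - 1 ⊗ g` is in the closure of `(d)` passes from `R` to `K`
(`IsPhiLocalization.diagonalSubring_eq_top`).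

The axioms of a vertex algebra follow.

* Translation: `(1 ⊗ ∂) d ^ n = - n d ^ (n - 1)`, and one integrates by parts
  (`nProduct_translation`).
* Vacuum: the unit `vac` is central, so that `vac_(n) X` and `X_(n) vac` vanish for `n ≥ 0`. Since
  `vac_(-1)` is the identity, it commutes with `∂`, and translation gives `vac_(n) X = 0` for
  `n ≤ -2` by descending induction (`nProduct_unit_left`). Since `∂ vac = 0`, translation expresses
  `X_(n) vac`, for `n < 0`, through the derivatives of `X_(-1) vac`
  (`exists_nProduct_unit_right`). The difference of `X_(-1) vac` and `vac_(-1) X` at `g` is, up to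
  sign, the value of `d ^ (-1) (X vac) - d ^ (-1) (vac X ∘ σ)` at `g ⊗ 1 - 1 ⊗ g`; it vanishes since
  this element is a limit of multiples of `d` and `[X, vac] = 0` (`nProduct_neg_one_comm`).
* Locality: `X_(m) (Y_(n) Z)` is the value of `XYZ - XZY - YZX + ZYX` at `(u - w) ^ m (v - w) ^ n`,
  each of the four terms being extended to a suitable completion (`prodExt_sub_prodSwapExt_eq`). In
  the commutator the two middle terms cancel and `[X, Y] Z - Z [X, Y]` remains. Multiplication of
  the formal distribution by `x - y` is multiplication by `(u - w) - (v - w) = u - v`, a power of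
  which kills `[X, Y]` (`nProduct_commutator_locality`).
-/

set_option linter.unusedSectionVars false

/-! ### Consequences of the existence of a global coordinate -/

section GlobalCoordinate

variable {A S : Type*} [CommRing A] [CommRing S] [Algebra A S]

/-- The kernel of the multiplication of the completed tensor square is generated by `z - w`; before
completion, it is contained in the closure of the ideal generated by `z - w`. -/
theorem tmul_sub_tmul_mem_closure_span [UniformSpace S] [IsUniformAddGroup S]
    [IsTopologicalRing S] [IsLinearTopology A S] [CompleteSpace S] [T2Space S] {z : S}
    (hz : IsGlobalCoordinate A z) (g : S) :
    (TopTensor.tmul .middle g 1 - TopTensor.tmul .middle 1 g : TopTensor A S .middle) ∈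
      closure (Ideal.span {coordDiff A .middle z} : Set (TopTensor A S .middle)) := by
  set x : TopTensor A S .middle := TopTensor.tmul .middle g 1 - TopTensor.tmul .middle 1 g
  have hx : (x : Completion (TopTensor A S .middle)) ∈
      RingHom.ker (Completion.extensionHom (mulTensor A S) (continuous_mulTensor A)) := by
    rw [RingHom.mem_ker, Completion.extensionHom_coe, map_sub, sub_eq_zero]
    have h1 : mulTensor A S (TopTensor.tmul .middle g 1) = g * 1 :=
      Algebra.TensorProduct.lmul'_apply_tmul g 1
    have h2 : mulTensor A S (TopTensor.tmul .middle 1 g) = 1 * g :=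
      Algebra.TensorProduct.lmul'_apply_tmul 1 g
    rw [h1, h2, mul_comm]
  rw [hz, Ideal.mem_span_singleton'] at hx
  obtain ⟨t, ht⟩ := hx
  rw [(Completion.isUniformInducing_coe _).isInducing.closure_eq_preimage_closure_image,
    Set.mem_preimage, ← ht]
  refine map_mem_closure
    (f := fun s => s * ((coordDiff A .middle z : TopTensor A S .middle) : Completion _))
    (continuous_mul_const _) (Completion.denseRange_coe t) ?_
  rintro _ ⟨s, rfl⟩
  exact ⟨s * coordDiff A .middle z, Ideal.mul_mem_left _ _ (Ideal.mem_span_singleton_self _),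
    Completion.coe_mul _ _⟩

/-- In the tensor square of a discrete quotient of `S` closures are not needed. -/
theorem tmul_sub_tmul_mem_span_of_discrete_quotient [TopologicalSpace S]
    [IsTopologicalRing S] [IsLinearTopology A S] {z g : S}
    (hg : (TopTensor.tmul .middle g 1 - TopTensor.tmul .middle 1 g : TopTensor A S .middle) ∈
      closure (Ideal.span {coordDiff A .middle z} : Set (TopTensor A S .middle)))
    {C : Type*} [CommRing C] [Algebra A C] (q : S →ₐ[A] C)
    (hq : IsOpen (LinearMap.ker q.toLinearMap : Set S)) :
    q g ⊗ₜ[A] 1 - 1 ⊗ₜ[A] q g ∈ Ideal.span {q z ⊗ₜ[A] (1 : C) - 1 ⊗ₜ[A] q z} := by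
  set M := LinearMap.ker q.toLinearMap
  set Q : S ⊗[A] S →ₐ[A] C ⊗[A] C := Algebra.TensorProduct.map q q
  have hQ : ∀ t ∈ tensorSubmodule M M, Q t = 0 := by
    have : tensorSubmodule M M ≤ LinearMap.ker Q.toLinearMap :=
      tensorSubmodule_le_iff.2 fun x hx y hy => by
        have hx' : q x = 0 := hx
        simp [Q, hx']
    exact fun t ht => this ht
  set x : TopTensor A S .middle := TopTensor.tmul .middle g 1 - TopTensor.tmul .middle 1 g
  have hmem : {t : TopTensor A S .middle | t - x ∈ {t : TopTensor A S .middle |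
      t ∈ tensorSubmodule M M}} ∈ 𝓝 x := by
    have h0 := (TopTensor.hasBasis_nhds_zero (A := A) (S := S) .middle).mem_of_mem
      (i := ⟨(M, M), hq, hq⟩) trivial
    have hc : Filter.Tendsto (fun t : TopTensor A S .middle => t - x) (𝓝 x) (𝓝 0) := by
      simpa using (continuous_sub_right x).tendsto x
    exact hc h0
  obtain ⟨y, hy, hys⟩ := mem_closure_iff_nhds.1 hg _ hmem
  have hQy : Q y = Q x := by
    have := hQ _ hy
    rw [← sub_eq_zero]
    exact (map_sub Q y x).symm.trans this
  have hQx : Q x = q g ⊗ₜ[A] 1 - 1 ⊗ₜ[A] q g := by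
    refine (map_sub Q (g ⊗ₜ[A] 1) (1 ⊗ₜ[A] g)).trans ?_
    simp [Q]
  rw [← hQx, ← hQy]
  obtain ⟨s, hs⟩ := Ideal.mem_span_singleton'.1 hys
  refine Ideal.mem_span_singleton'.2 ⟨Q s, ?_⟩
  rw [← hs]
  have : Q (coordDiff A .middle z) = q z ⊗ₜ[A] (1 : C) - 1 ⊗ₜ[A] q z := by
    refine (map_sub Q (z ⊗ₜ[A] 1) (1 ⊗ₜ[A] z)).trans ?_
    simp [Q]
  rw [← this]
  exact (map_mul Q s _).symm

/-- If `x ⊗ 1 - 1 ⊗ x` generates the ideal of the diagonal of the finite algebra `C`, then the map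
`A[X] → C`, `X ↦ x`, is an epimorphism of rings, and a finite epimorphism is surjective. -/
theorem aeval_surjective_of_tmul_sub_tmul_mem_span {C : Type*} [CommRing C] [Algebra A C]
    [Module.Finite A C] (x : C)
    (h : ∀ c : C, c ⊗ₜ[A] 1 - 1 ⊗ₜ[A] c ∈ Ideal.span {x ⊗ₜ[A] (1 : C) - 1 ⊗ₜ[A] x}) :
    Function.Surjective (Polynomial.aeval (R := A) x) := by
  let : Algebra (Polynomial A) C := (Polynomial.aeval (R := A) x).toAlgebra
  have : IsScalarTower A (Polynomial A) C :=
    IsScalarTower.of_algebraMap_eq fun a => by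
      change _ = Polynomial.aeval x (algebraMap A (Polynomial A) a)
      simp
  have : Module.Finite (Polynomial A) C := Module.Finite.of_restrictScalars_finite A _ C
  refine Algebra.isEpi_iff_surjective_algebraMap_of_finite.1
    ((Algebra.isEpi_iff_forall_one_tmul_eq (Polynomial A) C).2 fun c => ?_)
  -- The tensor square over `A[X]` is the quotient of `C ⊗[A] C` in which `x ⊗ 1 = 1 ⊗ x`.
  let Q : C ⊗[A] C →ₐ[A] C ⊗[Polynomial A] C :=
    Algebra.TensorProduct.lift
      ((Algebra.TensorProduct.includeLeft :
        C →ₐ[Polynomial A] C ⊗[Polynomial A] C).restrictScalars A)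
      ((Algebra.TensorProduct.includeRight :
        C →ₐ[Polynomial A] C ⊗[Polynomial A] C).restrictScalars A)
      (fun _ _ => Commute.all _ _)
  have hQ : ∀ a b, Q (a ⊗ₜ b) = a ⊗ₜ b := fun a b => by simp [Q]
  have hx : x = algebraMap (Polynomial A) C Polynomial.X := by
    change _ = Polynomial.aeval x Polynomial.X
    simp
  obtain ⟨t, ht⟩ := Ideal.mem_span_singleton'.1 (h c)
  have := congrArg Q ht
  rw [map_mul, map_sub, map_sub, hQ, hQ, hQ, hQ] at this
  have h0 : x ⊗ₜ[Polynomial A] (1 : C) = 1 ⊗ₜ[Polynomial A] x := by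
    rw [hx, Algebra.algebraMap_eq_smul_one, TensorProduct.smul_tmul]
  rw [h0, sub_self, mul_zero] at this
  exact (sub_eq_zero.1 this.symm).symm

end GlobalCoordinate

/-! ### Divisibility by powers of `φ` of polynomials in the coordinate -/

section PhiAdicCoordinate

open Polynomial

variable {A R : Type*} [CommRing A] [CommRing R] [Algebra A R] {φ : R}

variable (A φ) in
/-- Lifts of generators of `R / (φ)`, multiplied by the powers of `φ`, generate `R / (φ ^ n)`. -/
theorem exists_fg_add_span_pow [Module.Finite A (R ⧸ Ideal.span {φ})] (n : ℕ) :
    ∃ N : Submodule A R, N.FG ∧ ∀ r, ∃ s ∈ N, φ ^ n ∣ r - s := by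
  obtain ⟨k, c, hc⟩ := Module.Finite.exists_fin (R := A) (M := R ⧸ Ideal.span {φ})
  choose l hl using fun i => Ideal.Quotient.mk_surjective (c i)
  have h1 : ∀ r, ∃ s ∈ Submodule.span A (Set.range l), φ ∣ r - s := fun r => by
    have hr : Ideal.Quotient.mkₐ A (Ideal.span {φ}) r ∈
        (Submodule.span A (Set.range l)).map
          (Ideal.Quotient.mkₐ A (Ideal.span {φ})).toLinearMap := by
      rw [Submodule.map_span, ← Set.range_comp]
      have : ((Ideal.Quotient.mkₐ A (Ideal.span {φ})).toLinearMap : R → _) ∘ l = c :=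
        funext hl
      rw [this, hc]
      trivial
    obtain ⟨s, hs, hsr⟩ := hr
    exact ⟨s, hs, Ideal.mem_span_singleton.1 (Ideal.Quotient.eq.1 hsr.symm)⟩
  induction n with
  | zero => exact ⟨⊥, Submodule.fg_bot, fun r => ⟨0, zero_mem _, by simp⟩⟩
  | succ n ih =>
    obtain ⟨N, hN, h⟩ := ih
    refine ⟨N ⊔ (Submodule.span A (Set.range l)).map (LinearMap.mulLeft A (φ ^ n)),
      hN.sup ((Submodule.fg_span (Set.finite_range l)).map _), fun r => ?_⟩
    obtain ⟨s, hs, t, ht⟩ := h r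
    obtain ⟨s', hs', t', ht'⟩ := h1 t
    refine ⟨s + φ ^ n * s', Submodule.add_mem_sup hs ⟨s', hs', rfl⟩, t', ?_⟩
    linear_combination ht + φ ^ n * ht'

theorem finite_quotient_span_pow [Module.Finite A (R ⧸ Ideal.span {φ})] (n : ℕ) :
    Module.Finite A (R ⧸ Ideal.span {φ ^ n}) := by
  obtain ⟨N, hN, h⟩ := exists_fg_add_span_pow A φ n
  have htop : N.map (Ideal.Quotient.mkₐ A (Ideal.span {φ ^ n})).toLinearMap = ⊤ := by
    refine eq_top_iff.2 fun c _ => ?_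
    obtain ⟨r, rfl⟩ := Ideal.Quotient.mk_surjective c
    obtain ⟨s, hs, hsr⟩ := h r
    exact ⟨s, hs, (Ideal.Quotient.eq.2 (Ideal.mem_span_singleton.2 hsr)).symm⟩
  exact ⟨htop ▸ hN.map _⟩

/-- If `R / (φ ^ 2)` is generated by `z`, an approximation of `φ` modulo `φ ^ 2` by a polynomial
in `z` is a unit multiple of `φ`. -/
theorem exists_associated_aeval {z : R} (hunit : ∀ r, IsUnit (1 - φ * r))
    (hsurj : Function.Surjective
      (aeval (R := A) (Ideal.Quotient.mkₐ A (Ideal.span {φ ^ 2}) z))) :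
    ∃ f : A[X], Associated φ (aeval z f) := by
  obtain ⟨f, hf⟩ := hsurj (Ideal.Quotient.mkₐ A (Ideal.span {φ ^ 2}) φ)
  rw [aeval_algHom_apply] at hf
  obtain ⟨r, hr⟩ := Ideal.mem_span_singleton'.1 (Ideal.Quotient.eq.1 hf)
  refine ⟨f, ?_⟩
  have : aeval z f = φ * (1 - φ * (-r)) := by linear_combination -hr
  rw [this]
  exact associated_mul_unit_right _ _ (hunit _)

/-- Up to a unit, `φ` is the characteristic polynomial `P` of `z` on `R / (φ)`, evaluated at `z`:
the surjection `A[X] / (P) → R / (φ)` between free modules of the same rank is an isomorphism. -/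
theorem exists_associated_aeval_dvd [Nontrivial A] {z : R}
    (hfin : Module.Finite A (R ⧸ Ideal.span {φ})) (hfree : Module.Free A (R ⧸ Ideal.span {φ}))
    (hφ : φ ∈ nonZeroDivisors R)
    (hsurj : Function.Surjective (aeval (R := A) (Ideal.Quotient.mkₐ A (Ideal.span {φ}) z)))
    (hf : ∃ f : A[X], Associated φ (aeval z f)) :
    ∃ P : A[X], Associated φ (aeval z P) ∧ ∀ g : A[X], aeval z g ∈ Ideal.span {φ} → P ∣ g := by
  set q : R →ₐ[A] R ⧸ Ideal.span {φ} := Ideal.Quotient.mkₐ A (Ideal.span {φ})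
  have hq : ∀ g : A[X], aeval (q z) g = q (aeval z g) := fun g => aeval_algHom_apply q z g
  have hq0 : ∀ r, q r = 0 ↔ φ ∣ r := fun r =>
    Ideal.Quotient.eq_zero_iff_mem.trans Ideal.mem_span_singleton
  set P := (Algebra.lmul A (R ⧸ Ideal.span {φ}) (q z)).charpoly with hP
  have hPm : P.Monic := LinearMap.charpoly_monic _
  have hPz : aeval (q z) P = 0 := by
    have h := LinearMap.aeval_self_charpoly (Algebra.lmul A (R ⧸ Ideal.span {φ}) (q z))
    rw [aeval_algHom_apply] at h
    exact (mul_one _).symm.trans (congrArg (fun l => l 1) h)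
  have hdvd : ∀ g : A[X], aeval z g ∈ Ideal.span {φ} → P ∣ g := by
    have : Module.Free A (AdjoinRoot P) := Module.Free.of_basis (AdjoinRoot.powerBasis' hPm).basis
    have : Module.Finite A (AdjoinRoot P) := (AdjoinRoot.powerBasis' hPm).finite
    have hrank : Module.finrank A (R ⧸ Ideal.span {φ}) = Module.finrank A (AdjoinRoot P) := by
      rw [(AdjoinRoot.powerBasis' hPm).finrank, AdjoinRoot.powerBasis'_dim,
        LinearMap.charpoly_natDegree]
    let e := LinearEquiv.ofFinrankEq _ _ hrank
    let L : AdjoinRoot P →ₐ[A] R ⧸ Ideal.span {φ} :=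
      AdjoinRoot.liftAlgHom P (Algebra.ofId A _) (q z) (by simpa [aeval_def] using hPz)
    have hL : ∀ g : A[X], L (AdjoinRoot.mk P g) = aeval (q z) g := fun g => by
      simp [L, AdjoinRoot.liftAlgHom, AdjoinRoot.lift_mk, aeval_def]
    have hLs : Function.Surjective L := fun c => by
      obtain ⟨g, rfl⟩ := hsurj c
      exact ⟨_, hL g⟩
    -- `e ∘ L` is a surjective endomorphism of a finite module, hence injective.
    have hinj : Function.Injective (e.toLinearMap ∘ₗ L.toLinearMap) :=
      OrzechProperty.injective_of_surjective_endomorphism _ (e.surjective.comp hLs)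
    intro g hg
    rw [← AdjoinRoot.mk_eq_zero]
    apply hinj
    rw [map_zero, LinearMap.comp_apply, AlgHom.toLinearMap_apply, hL, hq,
      (hq0 _).2 (Ideal.mem_span_singleton.1 hg), map_zero]
  refine ⟨P, ?_, hdvd⟩
  obtain ⟨f, u, hu⟩ := hf
  have h1 : φ ∣ aeval z P := by rw [← hq0, ← hq, hPz]
  have h2 : P ∣ f := hdvd f (Ideal.mem_span_singleton.2 ⟨u, hu.symm⟩)
  have h3 : aeval z P ∣ φ := by
    rw [← Units.dvd_mul_right (u := u), hu]
    exact map_dvd _ h2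
  obtain ⟨r, hr⟩ := h1
  obtain ⟨s, hs⟩ := h3
  have hrs : φ * (r * s) = φ * 1 := by rw [← mul_assoc, ← hr, ← hs, mul_one]
  have := (mul_cancel_left_mem_nonZeroDivisors hφ).1 hrs
  rw [hr]
  exact associated_mul_unit_right _ _ (IsUnit.of_mul_eq_one s this)

theorem pow_dvd_of_aeval_mem_span_pow {z : R} (hφ : φ ∈ nonZeroDivisors R) {P : A[X]}
    (hPφ : Associated φ (aeval z P)) (hP : ∀ g : A[X], aeval z g ∈ Ideal.span {φ} → P ∣ g)
    (n : ℕ) (g : A[X]) (hg : φ ^ n ∣ aeval z g) : P ^ n ∣ g := by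
  induction n generalizing g with
  | zero => simp
  | succ n ih =>
    obtain ⟨h, rfl⟩ := hP g (Ideal.mem_span_singleton.2 ((dvd_pow_self φ n.succ_ne_zero).trans hg))
    rw [pow_succ']
    refine mul_dvd_mul_left _ (ih h ?_)
    obtain ⟨u, hu⟩ := hPφ
    rw [map_mul, ← hu, pow_succ', mul_assoc] at hg
    obtain ⟨c, hc⟩ := hg
    rw [mul_assoc] at hc
    have := (mul_cancel_left_mem_nonZeroDivisors hφ).1 hc
    exact (Units.dvd_mul_left (u := u)).1 ⟨c, this⟩

/-- The map `f(z) ↦ f'(z)` on `A[z]` is continuous for the `(φ)`-adic topology. -/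
theorem pow_dvd_aeval_derivative {z : R} (hφ : φ ∈ nonZeroDivisors R) {P : A[X]}
    (hPφ : Associated φ (aeval z P)) (hP : ∀ g : A[X], aeval z g ∈ Ideal.span {φ} → P ∣ g)
    (n : ℕ) (g : A[X]) (hg : φ ^ (n + 1) ∣ aeval z g) : φ ^ n ∣ aeval z (derivative g) := by
  obtain ⟨h, rfl⟩ := pow_dvd_of_aeval_mem_span_pow hφ hPφ hP _ _ hg
  have : P ^ n ∣ derivative (P ^ (n + 1) * h) := by
    rw [derivative_mul, derivative_pow]
    refine dvd_add (Dvd.dvd.mul_right (Dvd.dvd.mul_right (Dvd.dvd.mul_left ?_ _) _) _)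
      (Dvd.dvd.mul_right (pow_dvd_pow _ n.le_succ) _)
    simp
  exact (pow_dvd_pow_of_dvd hPφ.dvd n).trans (by simpa using map_dvd (aeval z) this)

end PhiAdicCoordinate

/-! ### Geometric series -/

section Geometric

/-- In a complete nonarchimedean ring, the geometric series of a topologically nilpotent element
converges. -/
theorem isUnit_one_sub_of_tendsto_pow {T : Type*} [CommRing T] [UniformSpace T]
    [IsUniformAddGroup T] [IsTopologicalRing T] [NonarchimedeanAddGroup T] [CompleteSpace T]
    [T2Space T] {u : T} (hu : Filter.Tendsto (fun n : ℕ => u ^ n) Filter.atTop (𝓝 0)) :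
    IsUnit (1 - u) := by
  have hc : CauchySeq fun n => ∑ i ∈ Finset.range n, u ^ i := by
    refine NonarchimedeanAddGroup.cauchySeq_of_tendsto_sub_nhds_zero ?_
    simpa [Finset.sum_range_succ] using hu
  obtain ⟨s, hs⟩ := cauchySeq_tendsto_of_complete hc
  have h1 : Filter.Tendsto (fun n => (1 - u) * ∑ i ∈ Finset.range n, u ^ i) Filter.atTop
      (𝓝 ((1 - u) * s)) := hs.const_mul _
  have h2 : Filter.Tendsto (fun n => (1 - u) * ∑ i ∈ Finset.range n, u ^ i) Filter.atTop
      (𝓝 (1 - 0)) := by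
    simp_rw [mul_neg_geom_sum]
    exact tendsto_const_nhds.sub hu
  rw [sub_zero] at h2
  exact IsUnit.of_mul_eq_one s (tendsto_nhds_unique h1 h2)

theorem nonarchimedeanAddGroup_of_isLinearTopology (A : Type*) {S : Type*} [CommRing A]
    [CommRing S] [Algebra A S] [TopologicalSpace S] [IsTopologicalRing S] [IsLinearTopology A S] :
    NonarchimedeanAddGroup S where
  is_nonarchimedean U hU := by
    obtain ⟨M, hM, hMU⟩ := exists_open_submodule_le (A := A) hU
    exact ⟨⟨M.toAddSubgroup, hM⟩, hMU⟩

end Geometric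

/-! ### Derivations of localizations -/

section LocalizationDerivation

/-- A derivation extends to a localization: view it as a morphism to the dual numbers, in which the
image of an element is invertible as soon as its first component is. -/
theorem exists_derivation_localization {A R K : Type*} [CommRing A] [CommRing R] [Algebra A R]
    [CommRing K] [Algebra A K] [Algebra R K] [IsScalarTower A R K] (φ : R)
    [IsLocalization.Away φ K] (D : Derivation A R R) :
    ∃ D' : Derivation A K K, ∀ r, D' (algebraMap R K r) = algebraMap R K (D r) := by
  let f : R →ₐ[A] TrivSqZeroExt K K :=
    { toFun := fun r => .inl (algebraMap R K r) + .inr (algebraMap R K (D r))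
      map_one' := by ext <;> simp
      map_mul' := fun x y => by
        ext <;> simp [Algebra.smul_def, mul_comm, TrivSqZeroExt.algebraMap_eq_inl]
      map_zero' := by ext <;> simp
      map_add' := fun x y => by ext <;> simp [Algebra.smul_def]
      commutes' := fun a => by
        ext <;> simp [← IsScalarTower.algebraMap_apply, TrivSqZeroExt.algebraMap_eq_inl'] }
  have hf : ∀ y : Submonoid.powers φ, IsUnit (f y) := fun y => by
    rw [TrivSqZeroExt.isUnit_iff_isUnit_fst]
    simpa [f] using IsLocalization.map_units K y
  let g : K →ₐ[A] TrivSqZeroExt K K := IsLocalization.liftAlgHom (M := Submonoid.powers φ) hf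
  have hg : ∀ r, g (algebraMap R K r) = f r := fun r => IsLocalization.lift_eq _ r
  have hfst : ∀ x, (g x).fst = x := by
    have : ((TrivSqZeroExt.fstHom A K K).comp g).toRingHom = RingHom.id K := by
      refine IsLocalization.ringHom_ext (Submonoid.powers φ) (RingHom.ext fun r => ?_)
      change (g (algebraMap R K r)).fst = algebraMap R K r
      rw [hg]
      simp [f]
    exact fun x => congrArg (fun l : K →+* K => l x) this
  refine ⟨Derivation.mk' ((TrivSqZeroExt.sndHom K K).restrictScalars A ∘ₗ g.toLinearMap)
    fun x y => ?_, fun r => ?_⟩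
  · simp [hfst, mul_comm]
  · change (g (algebraMap R K r)).snd = _
    rw [hg]
    simp [f, Algebra.smul_def, TrivSqZeroExt.algebraMap_eq_inl]

theorem pow_dvd_derivation_pow_mul {A R : Type*} [CommRing A] [CommRing R] [Algebra A R]
    (D : Derivation A R R) (φ : R) (n : ℕ) (r : R) : φ ^ n ∣ D (φ ^ (n + 1) * r) := by
  rw [Derivation.leibniz, Derivation.leibniz_pow]
  refine dvd_add (Dvd.dvd.mul_right (pow_dvd_pow _ n.le_succ) _) ⟨(n + 1) * r * D φ, ?_⟩
  simp only [Nat.add_sub_cancel, smul_eq_mul, nsmul_eq_mul]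
  push_cast
  ring

end LocalizationDerivation

/-! ### The subring `A[z]` of a `(φ)`-adic ring -/

section Density

open Polynomial

variable {A R : Type*} [CommRing A] [CommRing R] [Algebra A R] [UniformSpace R]
  [IsUniformAddGroup R] [IsTopologicalRing R] [IsLinearTopology A R] [CompleteSpace R] [T2Space R]
  {φ z : R}

theorem IsPhiAdicRing.hasBasis_nhds_zero (hR : IsPhiAdicRing A φ) :
    (𝓝 (0 : R)).HasBasis (fun _ : ℕ => True) fun n => {r | φ ^ n ∣ r} := by
  have h : ∀ n : ℕ, {r | φ ^ n ∣ r} = (((Ideal.span {φ}) ^ n : Ideal R) : Set R) := fun n => by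
    ext r
    rw [Ideal.span_singleton_pow, SetLike.mem_coe, Ideal.mem_span_singleton, Set.mem_ofPred_eq]
  simp_rw [h]
  exact hR.isAdic.hasBasis_nhds_zero

theorem IsPhiAdicRing.isOpen (hR : IsPhiAdicRing A φ) (n : ℕ) :
    IsOpen ((Ideal.span {φ ^ n} : Ideal R) : Set R) := by
  rw [← Ideal.span_singleton_pow]
  exact (isAdic_iff.1 hR.isAdic).1 n

theorem IsPhiAdicRing.tendsto_pow (hR : IsPhiAdicRing A φ) (r : R) :
    Filter.Tendsto (fun n : ℕ => (φ * r) ^ n) Filter.atTop (𝓝 0) := by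
  refine hR.hasBasis_nhds_zero.tendsto_right_iff.2 fun n _ => ?_
  filter_upwards [Filter.eventually_ge_atTop n] with k hk
  exact (pow_dvd_pow φ hk).trans (mul_pow φ r k ▸ dvd_mul_right _ _)

theorem IsPhiAdicRing.isUnit_one_sub_mul (hR : IsPhiAdicRing A φ) (r : R) :
    IsUnit (1 - φ * r) :=
  have := nonarchimedeanAddGroup_of_isLinearTopology A (S := R)
  isUnit_one_sub_of_tendsto_pow (hR.tendsto_pow r)

/-- Every class modulo `φ ^ n` is represented by a polynomial in the coordinate. -/
theorem IsPhiAdicRing.aeval_surjective (hR : IsPhiAdicRing A φ) (hz : IsGlobalCoordinate A z)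
    (n : ℕ) :
    Function.Surjective (aeval (R := A) (Ideal.Quotient.mkₐ A (Ideal.span {φ ^ n}) z)) := by
  have := hR.finite
  have := finite_quotient_span_pow (A := A) (φ := φ) n
  refine aeval_surjective_of_tmul_sub_tmul_mem_span _ fun c => ?_
  obtain ⟨g, rfl⟩ := Ideal.Quotient.mkₐ_surjective A (Ideal.span {φ ^ n}) c
  refine tmul_sub_tmul_mem_span_of_discrete_quotient (tmul_sub_tmul_mem_closure_span hz g) _ ?_
  convert hR.isOpen n
  ext r
  exact Ideal.Quotient.eq_zero_iff_mem

theorem IsPhiAdicRing.denseRange_aeval (hR : IsPhiAdicRing A φ) (hz : IsGlobalCoordinate A z) :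
    DenseRange (aeval (R := A) z) := by
  intro r
  refine mem_closure_iff_nhds.2 fun t ht => ?_
  have ht' : (fun x => r - x) ⁻¹' {x | r - x ∈ t} ∈ 𝓝 r := by simpa using ht
  have h0 : {x | r - x ∈ t} ∈ 𝓝 (0 : R) := by
    have : Filter.Tendsto (fun x => r - x) (𝓝 0) (𝓝 r) := by
      simpa using (continuous_sub_left r).tendsto (0 : R)
    exact this ht
  obtain ⟨n, -, hn⟩ := hR.hasBasis_nhds_zero.mem_iff.1 h0
  obtain ⟨f, hf⟩ := hR.aeval_surjective hz n (Ideal.Quotient.mkₐ A _ r)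
  rw [aeval_algHom_apply] at hf
  have hd := Ideal.mem_span_singleton.1 (Ideal.Quotient.eq.1 hf.symm)
  refine ⟨aeval z f, ?_, f, rfl⟩
  simpa using hn hd

theorem IsPhiAdicRing.exists_associated_aeval (hR : IsPhiAdicRing A φ)
    (hz : IsGlobalCoordinate A z) : ∃ P : A[X], Associated φ (aeval z P) ∧
      ∀ g : A[X], aeval z g ∈ Ideal.span {φ} → P ∣ g := by
  have : Nontrivial R := by
    by_contra h
    rw [not_nontrivial_iff_subsingleton] at h
    exact hR.not_isUnit (isUnit_of_subsingleton φ)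
  have : Nontrivial A := (algebraMap A R).domain_nontrivial
  refine exists_associated_aeval_dvd hR.finite hR.free hR.mem_nonZeroDivisors ?_
    (_root_.exists_associated_aeval hR.isUnit_one_sub_mul (hR.aeval_surjective hz 2))
  have := hR.aeval_surjective hz 1
  rwa [pow_one] at this

/-- The derivation `d / dz` of `A[z]` is continuous for the `(φ)`-adic topology, so it extends to
`R`, in which `A[z]` is dense. -/
theorem IsPhiAdicRing.exists_derivation (hR : IsPhiAdicRing A φ) (hz : IsGlobalCoordinate A z) :
    ∃ D : Derivation A R R, D z = 1 := by
  obtain ⟨P, hPφ, hP⟩ := hR.exists_associated_aeval hz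
  let : UniformSpace A[X] := UniformSpace.comap (aeval z) inferInstance
  have : IsUniformAddGroup A[X] := IsUniformAddGroup.comap (aeval (R := A) z)
  have hind : IsUniformInducing (aeval (R := A) z) := ⟨rfl⟩
  have : ContinuousConstSMul A R := ⟨fun a => by
    simp_rw [Algebra.smul_def]
    exact continuous_const_mul _⟩
  let δ : A[X] →L[A] R :=
    { toLinearMap := (aeval z).toLinearMap ∘ₗ derivative
      cont := by
        refine continuous_of_continuousAt_zero ((aeval z).toLinearMap ∘ₗ derivative) ?_
        rw [ContinuousAt, map_zero, hind.isInducing.nhds_eq_comap, map_zero]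
        refine (hR.hasBasis_nhds_zero.comap _).tendsto_iff hR.hasBasis_nhds_zero |>.2 fun n _ =>
          ⟨n + 1, trivial, fun g hg => ?_⟩
        exact pow_dvd_aeval_derivative hR.mem_nonZeroDivisors hPφ hP n g hg }
  let e : A[X] →L[A] R := ⟨(aeval z).toLinearMap, hind.uniformContinuous.continuous⟩
  have he : ∀ g, δ.extend e (aeval z g) = aeval z (derivative g) := fun g =>
    δ.extend_eq (hR.denseRange_aeval hz) hind g
  refine ⟨Derivation.mk' (δ.extend e).toLinearMap fun x y => ?_, ?_⟩
  · refine (hR.denseRange_aeval hz).induction_on₂ (p := fun x y => δ.extend e (x * y) =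
      x * δ.extend e y + y * δ.extend e x) ?_ (fun f g => ?_) x y
    · refine isClosed_eq ?_ ?_ <;> fun_prop
    · rw [← map_mul, he, he, he, derivative_mul]
      simp only [map_add, map_mul]
      ring
  · have := he X
    simpa using this

end Density

/-! ### Invertibility of `z - w` -/

section TopTensor

open Polynomial

variable {A S : Type*} [CommRing A] [CommRing S] [Algebra A S]

theorem TopTensor.tmul_mul_tmul (τ : TensorTopology) (a b c e : S) :
    (TopTensor.tmul τ a b * TopTensor.tmul τ c e : TopTensor A S τ) =
      TopTensor.tmul τ (a * c) (b * e) :=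
  Algebra.TensorProduct.tmul_mul_tmul a c b e

theorem TopTensor.tmul_one_one (τ : TensorTopology) :
    (TopTensor.tmul τ 1 1 : TopTensor A S τ) = 1 :=
  rfl

theorem TopTensor.tmul_pow (τ : TensorTopology) (a b : S) (n : ℕ) :
    (TopTensor.tmul τ a b ^ n : TopTensor A S τ) = TopTensor.tmul τ (a ^ n) (b ^ n) :=
  Algebra.TensorProduct.tmul_pow a b n

theorem coordDiff_dvd_tmul_aeval_sub (τ : TensorTopology) (z : S) (f : A[X]) :
    coordDiff A τ z ∣ TopTensor.tmul τ (aeval z f) 1 - TopTensor.tmul τ 1 (aeval z f) := by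
  have h : (z ⊗ₜ[A] (1 : S) - 1 ⊗ₜ[A] z) ∣ aeval z f ⊗ₜ[A] (1 : S) - 1 ⊗ₜ[A] aeval z f := by
    have h1 : aeval z f ⊗ₜ[A] (1 : S) = aeval (z ⊗ₜ[A] (1 : S)) f :=
      (aeval_algHom_apply (Algebra.TensorProduct.includeLeft : S →ₐ[A] S ⊗[A] S) z f).symm
    have h2 : (1 : S) ⊗ₜ[A] aeval z f = aeval ((1 : S) ⊗ₜ[A] z) f :=
      (aeval_algHom_apply (Algebra.TensorProduct.includeRight : S →ₐ[A] S ⊗[A] S) z f).symm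
    rw [h1, h2, ← eval_map_algebraMap, ← eval_map_algebraMap]
    exact sub_dvd_eval_sub _ _ _
  exact h

variable [TopologicalSpace S] [IsTopologicalRing S] [IsLinearTopology A S]

instance (τ : TensorTopology) : NonarchimedeanAddGroup (TopTensor A S τ) :=
  ⟨(tensor_ringSubgroupsBasis A S τ).nonarchimedean.is_nonarchimedean⟩

theorem TopTensor.tendsto_tmul_left {ι : Type*} {l : Filter ι} {a b : ι → S}
    (ha : Filter.Tendsto a l (𝓝 0)) :
    Filter.Tendsto (fun i => (TopTensor.tmul .left (a i) (b i) : TopTensor A S .left)) l (𝓝 0) := by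
  refine (TopTensor.hasBasis_nhds_zero .left).tendsto_right_iff.2 ?_
  rintro ⟨⟨M, N⟩, hM, hN⟩ -
  filter_upwards [ha (hM.mem_nhds M.zero_mem)] with i hi
  obtain rfl : N = ⊤ := hN
  exact tmul_mem_tensorSubmodule hi trivial

theorem TopTensor.tendsto_tmul_right {ι : Type*} {l : Filter ι} {a b : ι → S}
    (hb : Filter.Tendsto b l (𝓝 0)) :
    Filter.Tendsto (fun i => (TopTensor.tmul .right (a i) (b i) : TopTensor A S .right)) l
      (𝓝 0) := by
  refine (TopTensor.hasBasis_nhds_zero .right).tendsto_right_iff.2 ?_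
  rintro ⟨⟨M, N⟩, hM, hN⟩ -
  filter_upwards [hb (hN.mem_nhds N.zero_mem)] with i hi
  obtain rfl : M = ⊤ := hM
  exact tmul_mem_tensorSubmodule trivial hi

theorem Completion.isUnit_coe_one_sub {τ : TensorTopology} {u : TopTensor A S τ}
    (hu : Filter.Tendsto (fun n : ℕ => u ^ n) Filter.atTop (𝓝 0)) :
    IsUnit ((1 - u : TopTensor A S τ) : Completion (TopTensor A S τ)) := by
  rw [Completion.coe_sub, Completion.coe_one]
  refine isUnit_one_sub_of_tendsto_pow ?_
  have h : (fun n : ℕ => (u : Completion (TopTensor A S τ)) ^ n) =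
      fun n : ℕ => ((u ^ n : TopTensor A S τ) : Completion (TopTensor A S τ)) :=
    funext fun n => (map_pow Completion.coeRingHom u n).symm
  rw [h]
  exact ((Completion.continuous_coe _).tendsto _).comp hu

/-- If `p` is a polynomial in `z` which is invertible and topologically nilpotent, `z - w` is
invertible in the completion for the left topology: it divides `p(z) - p(w)`, which is
`- p(w) (1 - p(z) / p(w))`. -/
theorem isUnit_coordDiff_left {z p q : S} (hpq : p * q = 1)
    (hp : Filter.Tendsto (fun n : ℕ => p ^ n) Filter.atTop (𝓝 0)) {f : A[X]} (hf : aeval z f = p) :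
    IsUnit ((coordDiff A .left z : TopTensor A S .left) : Completion (TopTensor A S .left)) := by
  have hdvd := coordDiff_dvd_tmul_aeval_sub .left z f
  have h1 : (TopTensor.tmul .left (aeval z f) 1 - TopTensor.tmul .left 1 (aeval z f) :
      TopTensor A S .left) =
      TopTensor.tmul .left 1 (-p) * (1 - TopTensor.tmul .left p q) := by
    have : (TopTensor.tmul .left 1 (-p) : TopTensor A S .left) = - TopTensor.tmul .left 1 p :=
      TensorProduct.tmul_neg _ _
    rw [mul_sub, mul_one, this, neg_mul, TopTensor.tmul_mul_tmul, hpq, hf, one_mul]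
    abel
  have h2 : IsUnit (TopTensor.tmul .left 1 (-p) : TopTensor A S .left) :=
    IsUnit.of_mul_eq_one (TopTensor.tmul .left 1 (-q)) (by
      rw [TopTensor.tmul_mul_tmul, neg_mul_neg, hpq, one_mul, TopTensor.tmul_one_one])
  rw [h1] at hdvd
  refine isUnit_of_dvd_unit (map_dvd Completion.coeRingHom hdvd) ?_
  rw [map_mul]
  refine (h2.map Completion.coeRingHom).mul (Completion.isUnit_coe_one_sub ?_)
  simp_rw [TopTensor.tmul_pow]
  exact TopTensor.tendsto_tmul_left hp

/-- The counterpart of `isUnit_coordDiff_left` for the right topology, in which `p(w)` is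
topologically nilpotent: `p(z) - p(w) = p(z) (1 - p(w) / p(z))`. -/
theorem isUnit_coordDiff_right {z p q : S} (hpq : p * q = 1)
    (hp : Filter.Tendsto (fun n : ℕ => p ^ n) Filter.atTop (𝓝 0)) {f : A[X]} (hf : aeval z f = p) :
    IsUnit ((coordDiff A .right z : TopTensor A S .right) :
      Completion (TopTensor A S .right)) := by
  have hdvd := coordDiff_dvd_tmul_aeval_sub .right z f
  have h1 : (TopTensor.tmul .right (aeval z f) 1 - TopTensor.tmul .right 1 (aeval z f) :
      TopTensor A S .right) =
      TopTensor.tmul .right p 1 * (1 - TopTensor.tmul .right q p) := by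
    rw [mul_sub, mul_one, TopTensor.tmul_mul_tmul, hpq, hf, one_mul]
  have h2 : IsUnit (TopTensor.tmul .right p 1 : TopTensor A S .right) :=
    IsUnit.of_mul_eq_one (TopTensor.tmul .right q 1) (by
      rw [TopTensor.tmul_mul_tmul, hpq, one_mul, TopTensor.tmul_one_one])
  rw [h1] at hdvd
  refine isUnit_of_dvd_unit (map_dvd Completion.coeRingHom hdvd) ?_
  rw [map_mul]
  refine (h2.map Completion.coeRingHom).mul (Completion.isUnit_coe_one_sub ?_)
  simp_rw [TopTensor.tmul_pow]
  exact TopTensor.tendsto_tmul_right hp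

end TopTensor

/-! ### The closure of the ideal generated by `z - w` -/

section Diagonal

variable {A S : Type*} [CommRing A] [CommRing S] [Algebra A S] [TopologicalSpace S]
  [IsTopologicalRing S] [IsLinearTopology A S]

variable (A) in
/-- The elements `g` such that `g ⊗ 1 - 1 ⊗ g` is, up to arbitrarily small elements for the
middle topology, a multiple of `z - w`. They form a subring. -/
def diagonalSubring (z : S) : Subring S where
  carrier := {g | (TopTensor.tmul .middle g 1 - TopTensor.tmul .middle 1 g :
    TopTensor A S .middle) ∈ (Ideal.span {coordDiff A .middle z}).closure}
  one_mem' := by simp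
  zero_mem' := by
    have h1 : (TopTensor.tmul .middle 0 1 : TopTensor A S .middle) = 0 :=
      TensorProduct.zero_tmul _ _
    have h2 : (TopTensor.tmul .middle 1 0 : TopTensor A S .middle) = 0 :=
      TensorProduct.tmul_zero _ _
    simp [h1, h2]
  add_mem' {g h} hg hh := by
    have h1 : (TopTensor.tmul .middle (g + h) 1 : TopTensor A S .middle) =
      TopTensor.tmul .middle g 1 + TopTensor.tmul .middle h 1 := TensorProduct.add_tmul _ _ _
    have h2 : (TopTensor.tmul .middle 1 (g + h) : TopTensor A S .middle) =
      TopTensor.tmul .middle 1 g + TopTensor.tmul .middle 1 h := TensorProduct.tmul_add _ _ _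
    simp only [Set.mem_ofPred_eq, h1, h2] at hg hh ⊢
    have := add_mem hg hh
    convert this using 1
    abel
  neg_mem' {g} hg := by
    have h1 : (TopTensor.tmul .middle (-g) 1 : TopTensor A S .middle) =
      -TopTensor.tmul .middle g 1 := TensorProduct.neg_tmul _ _
    have h2 : (TopTensor.tmul .middle 1 (-g) : TopTensor A S .middle) =
      -TopTensor.tmul .middle 1 g := TensorProduct.tmul_neg _ _
    simp only [Set.mem_ofPred_eq, h1, h2] at hg ⊢
    have := neg_mem hg
    convert this using 1
    abel
  mul_mem' {g h} hg hh := by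
    simp only [Set.mem_ofPred_eq] at hg hh ⊢
    have h1 := add_mem (Ideal.mul_mem_left _ (TopTensor.tmul .middle g 1) hh)
      (Ideal.mul_mem_left _ (TopTensor.tmul .middle 1 h) hg)
    convert h1 using 1
    simp only [mul_sub, TopTensor.tmul_mul_tmul, one_mul, mul_one, mul_comm h g]
    abel

theorem mem_diagonalSubring {z g : S} : g ∈ diagonalSubring A z ↔
    (TopTensor.tmul .middle g 1 - TopTensor.tmul .middle 1 g : TopTensor A S .middle) ∈
      closure (Ideal.span {coordDiff A .middle z} : Set (TopTensor A S .middle)) :=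
  Iff.rfl

/-- `h ⊗ 1 - 1 ⊗ h = - (h ⊗ h) (g ⊗ 1 - 1 ⊗ g)` if `g h = 1`. -/
theorem mem_diagonalSubring_of_mul_eq_one {z g h : S} (hgh : g * h = 1)
    (hg : g ∈ diagonalSubring A z) : h ∈ diagonalSubring A z := by
  have h1 := Ideal.mul_mem_left (Ideal.span {coordDiff A .middle z}).closure
    (-TopTensor.tmul .middle h h) hg
  change _ ∈ (Ideal.span {coordDiff A .middle z}).closure
  convert h1 using 1
  simp only [neg_mul, mul_sub, TopTensor.tmul_mul_tmul, mul_comm h g, hgh, mul_one]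
  abel

end Diagonal

/-! ### Functoriality of the topologies on the tensor square -/

section Functoriality

variable {A S S' : Type*} [CommRing A] [CommRing S] [Algebra A S] [CommRing S'] [Algebra A S']

/-- The map `j ⊗ k`, for `S ⊗ S` and `S' ⊗ S'` endowed with the topology `τ`. -/
noncomputable def TopTensor.mapHom (τ : TensorTopology) (j k : S →ₗ[A] S') :
    TopTensor A S τ →+ TopTensor A S' τ :=
  (TensorProduct.map j k).toAddMonoidHom

theorem TopTensor.mapHom_tmul (τ : TensorTopology) (j k : S →ₗ[A] S') (a b : S) :
    TopTensor.mapHom τ j k (TopTensor.tmul τ a b) = TopTensor.tmul τ (j a) (k b) :=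
  TensorProduct.map_tmul j k a b

variable [TopologicalSpace S] [IsTopologicalRing S] [IsLinearTopology A S]
  [TopologicalSpace S'] [IsTopologicalRing S'] [IsLinearTopology A S']

theorem TopTensor.continuous_mapHom (τ : TensorTopology) {j k : S →ₗ[A] S'} (hj : Continuous j)
    (hk : Continuous k) : Continuous (TopTensor.mapHom τ j k) := by
  refine continuous_of_continuousAt_zero (TopTensor.mapHom τ j k) ?_
  rw [ContinuousAt, map_zero]
  refine (TopTensor.hasBasis_nhds_zero τ).tendsto_iff (TopTensor.hasBasis_nhds_zero τ) |>.2 ?_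
  rintro ⟨⟨M, N⟩, hM, hN⟩ -
  have hM' : τ.fst (M.comap j) := by
    cases τ
    · exact hM.preimage hj
    · exact hM.preimage hj
    · rw [show M = ⊤ from hM]; rfl
  have hN' : τ.snd (N.comap k) := by
    cases τ
    · exact hN.preimage hk
    · rw [show N = ⊤ from hN]; rfl
    · exact hN.preimage hk
  refine ⟨⟨(M.comap j, N.comap k), hM', hN'⟩, trivial, ?_⟩
  have h : tensorSubmodule (M.comap j) (N.comap k) ≤
      (tensorSubmodule M N).comap (TensorProduct.map j k) :=
    tensorSubmodule_le_iff.2 fun x hx y hy => tmul_mem_tensorSubmodule (M := M) (N := N) hx hy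
  exact fun t ht => h ht

theorem map_mem_diagonalSubring {z g : S} (j : S →ₐ[A] S') (hj : Continuous j)
    (hg : g ∈ diagonalSubring A z) : j g ∈ diagonalSubring A (j z) := by
  rw [mem_diagonalSubring] at hg ⊢
  have hc := TopTensor.continuous_mapHom (A := A) .middle (j := j.toLinearMap) (k := j.toLinearMap)
    hj hj
  have hsub : ∀ a : S, Algebra.TensorProduct.map j j (a ⊗ₜ[A] 1 - 1 ⊗ₜ[A] a) =
      j a ⊗ₜ[A] 1 - 1 ⊗ₜ[A] j a := fun a => by simp
  have hmul : ∀ t : S ⊗[A] S, Algebra.TensorProduct.map j j (t * (z ⊗ₜ[A] 1 - 1 ⊗ₜ[A] z)) =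
      Algebra.TensorProduct.map j j t * (j z ⊗ₜ[A] 1 - 1 ⊗ₜ[A] j z) := fun t => by
    rw [map_mul, hsub]
  have := map_mem_closure (t := (Ideal.span {coordDiff A .middle (j z)} :
    Set (TopTensor A S' .middle))) hc hg ?_
  · convert this using 1
    exact (hsub g).symm
  · intro t ht
    obtain ⟨s, rfl⟩ := Ideal.mem_span_singleton'.1 ht
    exact Ideal.mem_span_singleton'.2
      ⟨TopTensor.mapHom .middle j.toLinearMap j.toLinearMap s, (hmul s).symm⟩

end Functoriality

/-! ### The coordinate on the localization `K` -/

section PhiLocalization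

open Polynomial

variable {A R K : Type*} [CommRing A]
  [CommRing R] [Algebra A R] [UniformSpace R] [IsUniformAddGroup R] [IsTopologicalRing R]
  [IsLinearTopology A R] [CompleteSpace R] [T2Space R]
  [CommRing K] [Algebra A K] [Algebra R K] [IsScalarTower A R K]
  [TopologicalSpace K] [IsTopologicalRing K] [IsLinearTopology A K]
  {φ z : R}

theorem IsPhiLocalization.hasBasis_nhds_zero (hK : IsPhiLocalization K φ) :
    (𝓝 (0 : K)).HasBasis (fun _ : ℕ => True)
      fun n => {x | ∃ r, algebraMap R K (φ ^ n * r) = x} := by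
  have h : ∀ n : ℕ, {x | ∃ r, algebraMap R K (φ ^ n * r) = x} =
      algebraMap R K '' (Ideal.span {φ ^ n} : Ideal R) := fun n => by
    ext x
    simp only [Set.mem_ofPred_eq, Set.mem_image, SetLike.mem_coe, Ideal.mem_span_singleton]
    exact ⟨fun ⟨r, hr⟩ => ⟨_, dvd_mul_right _ r, hr⟩, fun ⟨_, ⟨r, hr⟩, hx⟩ => ⟨r, hr ▸ hx⟩⟩
  simp_rw [h]
  exact hK.hasBasis

theorem IsPhiLocalization.continuous_algebraMap (hR : IsPhiAdicRing A φ)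
    (hK : IsPhiLocalization K φ) : Continuous (algebraMap R K) := by
  refine continuous_of_continuousAt_zero (algebraMap R K) ?_
  rw [ContinuousAt, map_zero]
  refine hR.hasBasis_nhds_zero.tendsto_iff hK.hasBasis_nhds_zero |>.2 fun n _ =>
    ⟨n, trivial, ?_⟩
  rintro _ ⟨r, rfl⟩
  exact ⟨r, rfl⟩

/-- The closure of the ideal `(z - w)` of `K ⊗ K` contains all `g ⊗ 1 - 1 ⊗ g`: for `g ∈ R` by the
definition of a global coordinate, and these `g` form a subring stable under inversion. -/
theorem IsPhiLocalization.diagonalSubring_eq_top (hR : IsPhiAdicRing A φ)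
    (hK : IsPhiLocalization K φ) (hz : IsGlobalCoordinate A z) :
    diagonalSubring A (algebraMap R K z) = ⊤ := by
  have := hK.away
  have hR' : ∀ r : R, algebraMap R K r ∈ diagonalSubring A (algebraMap R K z) := fun r =>
    map_mem_diagonalSubring (IsScalarTower.toAlgHom A R K) (hK.continuous_algebraMap hR)
      (mem_diagonalSubring.2 (tmul_sub_tmul_mem_closure_span hz r))
  refine eq_top_iff.2 fun g _ => ?_
  obtain ⟨n, r, hr⟩ := IsLocalization.Away.surj φ g
  obtain ⟨h, hh⟩ := ((IsLocalization.Away.algebraMap_isUnit (S := K) φ).pow n).exists_right_inv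
  rw [← map_pow] at hh
  have hg : g = algebraMap R K r * h := by
    rw [← hr, mul_assoc, ← map_pow, hh, mul_one]
  rw [hg]
  exact mul_mem (hR' r) (mem_diagonalSubring_of_mul_eq_one hh (hR' _))

/-- Some polynomial in `z` is invertible and topologically nilpotent in `K`: one that is a unit
multiple of `φ`. -/
theorem IsPhiLocalization.exists_aeval (hR : IsPhiAdicRing A φ)
    (hK : IsPhiLocalization K φ) (hz : IsGlobalCoordinate A z) :
    ∃ (f : A[X]) (q : K), aeval (algebraMap R K z) f * q = 1 ∧
      Filter.Tendsto (fun n : ℕ => aeval (algebraMap R K z) f ^ n) Filter.atTop (𝓝 0) := by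
  have := hK.away
  obtain ⟨f, ⟨u, hu⟩, -⟩ := hR.exists_associated_aeval hz
  have hf : aeval (algebraMap R K z) f = algebraMap R K (φ * u) := by
    rw [hu, aeval_algebraMap_apply]
  have h1 : IsUnit (algebraMap R K (φ * u)) := by
    rw [map_mul]
    exact (IsLocalization.Away.algebraMap_isUnit φ).mul (u.isUnit.map _)
  obtain ⟨q, hq⟩ := h1.exists_right_inv
  refine ⟨f, q, hf ▸ hq, ?_⟩
  simp_rw [hf, ← map_pow]
  have := ((hK.continuous_algebraMap hR).tendsto 0).comp (hR.tendsto_pow (u : R))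
  rwa [map_zero] at this

theorem IsPhiLocalization.isUnit_coordDiff_left (hR : IsPhiAdicRing A φ)
    (hK : IsPhiLocalization K φ) (hz : IsGlobalCoordinate A z) :
    IsUnit ((coordDiff A .left (algebraMap R K z) : TopTensor A K .left) :
      Completion (TopTensor A K .left)) := by
  obtain ⟨f, q, hq, ht⟩ := hK.exists_aeval hR hz
  exact _root_.isUnit_coordDiff_left hq ht rfl

theorem IsPhiLocalization.isUnit_coordDiff_right (hR : IsPhiAdicRing A φ)
    (hK : IsPhiLocalization K φ) (hz : IsGlobalCoordinate A z) :
    IsUnit ((coordDiff A .right (algebraMap R K z) : TopTensor A K .right) :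
      Completion (TopTensor A K .right)) := by
  obtain ⟨f, q, hq, ht⟩ := hK.exists_aeval hR hz
  exact _root_.isUnit_coordDiff_right hq ht rfl

/-- The extension to `K` of a derivation of `R` maps `φ ^ (n + 1) R` into `φ ^ n R`, so it is
continuous. -/
theorem IsPhiLocalization.exists_derivation (hR : IsPhiAdicRing A φ)
    (hK : IsPhiLocalization K φ) (hz : IsGlobalCoordinate A z) :
    ∃ D : Derivation A K K, Continuous D ∧ D (algebraMap R K z) = 1 := by
  have := hK.away
  obtain ⟨D, hD⟩ := hR.exists_derivation hz
  obtain ⟨D', hD'⟩ := exists_derivation_localization (K := K) φ D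
  refine ⟨D', ?_, by rw [hD', hD, map_one]⟩
  refine continuous_of_continuousAt_zero D' ?_
  rw [ContinuousAt, map_zero]
  refine hK.hasBasis_nhds_zero.tendsto_iff hK.hasBasis_nhds_zero |>.2 fun n _ =>
    ⟨n + 1, trivial, ?_⟩
  rintro _ ⟨r, rfl⟩
  obtain ⟨s, hs⟩ := pow_dvd_derivation_pow_mul D φ n r
  exact ⟨s, by rw [hD', hs]⟩

theorem IsPhiLocalization.coordDeriv_apply_self (hR : IsPhiAdicRing A φ)
    (hK : IsPhiLocalization K φ) (hz : IsGlobalCoordinate A z) :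
    coordDeriv A (algebraMap R K z) (algebraMap R K z) = 1 := by
  have h := hK.exists_derivation hR hz
  rw [coordDeriv, dif_pos h]
  exact h.choose_spec.2

end PhiLocalization

/-! ### The powers of `z - w` and the derivation `1 ⊗ ∂` -/

section TensorCompletion

variable {A K U : Type*} [CommRing A] [CommRing K] [Algebra A K] [TopologicalSpace K]
  [IsTopologicalRing K] [IsLinearTopology A K]

theorem TopTensor.addHom_ext {τ : TensorTopology} {M : Type*} [AddMonoid M]
    {f g : TopTensor A K τ →+ M}
    (h : ∀ a b, f (TopTensor.tmul τ a b) = g (TopTensor.tmul τ a b)) : f = g := by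
  refine AddMonoidHom.ext fun t => ?_
  have key : ∀ s : K ⊗[A] K, f s = g s := fun s => by
    induction s with
    | zero => exact (map_zero f).trans (map_zero g).symm
    | tmul a b => exact h a b
    | add s t hs ht => exact (map_add f s t).trans ((congrArg₂ _ hs ht).trans (map_add g s t).symm)
  exact key t

/-- Two continuous additive maps on a completed tensor square agree if they agree on pure
tensors. -/
theorem TopTensor.completion_hom_ext {τ : TensorTopology} {M : Type*} [AddMonoid M]
    [TopologicalSpace M] [T2Space M] {f g : Completion (TopTensor A K τ) →+ M}
    (hf : Continuous f) (hg : Continuous g)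
    (h : ∀ a b, f ((TopTensor.tmul τ a b : TopTensor A K τ) : Completion (TopTensor A K τ)) =
      g ((TopTensor.tmul τ a b : TopTensor A K τ) : Completion (TopTensor A K τ))) : f = g := by
  have h' : f.comp Completion.toCompl = g.comp Completion.toCompl := TopTensor.addHom_ext h
  refine AddMonoidHom.ext fun x => ?_
  induction x using Completion.induction_on with
  | hp => exact isClosed_eq hf hg
  | ih t => exact DFunLike.congr_fun h' t

theorem coordDiffZPow_zero (τ : TensorTopology) (z : K) : coordDiffZPow A τ z 0 = 1 :=
  pow_zero _

theorem coordDiffZPow_add_one {τ : TensorTopology} {z : K}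
    (hz : IsUnit ((coordDiff A τ z : TopTensor A K τ) : Completion (TopTensor A K τ))) (n : ℤ) :
    coordDiffZPow A τ z (n + 1) =
      ((coordDiff A τ z : TopTensor A K τ) : Completion (TopTensor A K τ)) *
        coordDiffZPow A τ z n := by
  match n with
  | .ofNat n => exact pow_succ' _ n
  | .negSucc 0 =>
    change ((coordDiff A τ z : TopTensor A K τ) : Completion (TopTensor A K τ)) ^ 0 =
      _ * Ring.inverse ((coordDiff A τ z : TopTensor A K τ) : Completion (TopTensor A K τ)) ^
        (0 + 1)
    rw [pow_zero, zero_add, pow_one, Ring.mul_inverse_cancel _ hz]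
  | .negSucc (n + 1) =>
    have : Int.negSucc (n + 1) + 1 = Int.negSucc n := by omega
    rw [this]
    change Ring.inverse ((coordDiff A τ z : TopTensor A K τ) : Completion (TopTensor A K τ)) ^
        (n + 1) =
      _ * Ring.inverse ((coordDiff A τ z : TopTensor A K τ) : Completion (TopTensor A K τ)) ^
        (n + 1 + 1)
    rw [pow_succ' _ (n + 1), ← mul_assoc, Ring.mul_inverse_cancel _ hz, one_mul]

theorem coordDiffZPow_natCast (τ : TensorTopology) (z : K) (n : ℕ) :
    coordDiffZPow A τ z n =
      ((coordDiff A τ z ^ n : TopTensor A K τ) : Completion (TopTensor A K τ)) :=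
  (map_pow Completion.coeRingHom _ n).symm

variable (A) in
/-- The derivation `1 ⊗ ∂` of the completion of `K ⊗ K` for the topology `τ`. -/
noncomputable def coordDerivSnd (τ : TensorTopology) (z : K) :
    Completion (TopTensor A K τ) →+ Completion (TopTensor A K τ) :=
  (TopTensor.mapHom τ LinearMap.id (coordDeriv A z : K →ₗ[A] K)).completion
    (TopTensor.continuous_mapHom τ continuous_id (continuous_coordDeriv A z))

theorem continuous_coordDerivSnd (τ : TensorTopology) (z : K) :
    Continuous (coordDerivSnd A τ z) :=
  AddMonoidHom.continuous_completion _ _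

theorem coordDerivSnd_coe (τ : TensorTopology) (z : K) (t : TopTensor A K τ) :
    coordDerivSnd A τ z t =
      (TopTensor.mapHom τ LinearMap.id (coordDeriv A z : K →ₗ[A] K) t : TopTensor A K τ) :=
  AddMonoidHom.completion_coe _ _ t

theorem coordDerivSnd_tmul (τ : TensorTopology) (z a b : K) :
    coordDerivSnd A τ z (TopTensor.tmul τ a b : TopTensor A K τ) =
      (TopTensor.tmul τ a (coordDeriv A z b) : TopTensor A K τ) := by
  rw [coordDerivSnd_coe, TopTensor.mapHom_tmul]
  rfl

theorem coordDerivSnd_mul (τ : TensorTopology) (z : K) (x y : Completion (TopTensor A K τ)) :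
    coordDerivSnd A τ z (x * y) = coordDerivSnd A τ z x * y + x * coordDerivSnd A τ z y := by
  have hc := continuous_coordDerivSnd (A := A) τ z
  have hx : ∀ x : Completion (TopTensor A K τ),
      (coordDerivSnd A τ z).comp (AddMonoidHom.mulLeft x) =
        AddMonoidHom.mulLeft (coordDerivSnd A τ z x) +
          (AddMonoidHom.mulLeft x).comp (coordDerivSnd A τ z) := by
    intro x
    refine TopTensor.completion_hom_ext (hc.comp (continuous_const_mul x))
      ((continuous_const_mul _).add ((continuous_const_mul x).comp hc)) fun c e => ?_
    have hy : (coordDerivSnd A τ z).comp (AddMonoidHom.mulRight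
        ((TopTensor.tmul τ c e : TopTensor A K τ) : Completion (TopTensor A K τ))) =
        (AddMonoidHom.mulRight ((TopTensor.tmul τ c e : TopTensor A K τ) :
          Completion (TopTensor A K τ))).comp (coordDerivSnd A τ z) +
          AddMonoidHom.mulRight (coordDerivSnd A τ z
            ((TopTensor.tmul τ c e : TopTensor A K τ) : Completion (TopTensor A K τ))) := by
      refine TopTensor.completion_hom_ext (hc.comp (continuous_mul_const _))
        (((continuous_mul_const _).comp hc).add (continuous_mul_const _)) fun a b => ?_
      simp only [AddMonoidHom.comp_apply, AddMonoidHom.add_apply, AddMonoidHom.mulRight_apply,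
        coordDerivSnd_tmul, ← Completion.coe_mul, TopTensor.tmul_mul_tmul, Derivation.leibniz,
        ← Completion.coe_add, smul_eq_mul]
      congr 1
      rw [mul_comm (coordDeriv A z b) e, add_comm (TopTensor.tmul τ _ _)]
      exact TensorProduct.tmul_add _ _ _
    exact DFunLike.congr_fun hy x
  exact DFunLike.congr_fun (hx x) y

theorem coordDerivSnd_coordDiff (τ : TensorTopology) {z : K} (hz : coordDeriv A z z = 1) :
    coordDerivSnd A τ z (coordDiff A τ z : TopTensor A K τ) = -1 := by
  have h0 : (TopTensor.tmul τ z 0 : TopTensor A K τ) = 0 := TensorProduct.tmul_zero _ _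
  rw [coordDiff, Completion.coe_sub, map_sub, coordDerivSnd_tmul, coordDerivSnd_tmul, hz,
    TopTensor.tmul_one_one, Completion.coe_one, Derivation.map_one_eq_zero, h0,
    Completion.coe_zero, zero_sub]

/-- `(1 ⊗ ∂) (z - w) ^ n = - n (z - w) ^ (n - 1)`. -/
theorem coordDerivSnd_coordDiffZPow {τ : TensorTopology} {z : K}
    (hd : IsUnit ((coordDiff A τ z : TopTensor A K τ) : Completion (TopTensor A K τ)))
    (hz : coordDeriv A z z = 1) (n : ℤ) :
    coordDerivSnd A τ z (coordDiffZPow A τ z n) = (-n) • coordDiffZPow A τ z (n - 1) := by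
  have hone : coordDerivSnd A τ z (1 : Completion (TopTensor A K τ)) = 0 := by
    have := coordDerivSnd_mul (A := A) τ z 1 1
    simpa using this
  -- The defect `e n` of the formula satisfies `e (n + 1) = (z - w) e n` and vanishes at `0`.
  set e : ℤ → Completion (TopTensor A K τ) := fun n =>
    coordDerivSnd A τ z (coordDiffZPow A τ z n) + n • coordDiffZPow A τ z (n - 1) with he
  have hstep : ∀ n, e (n + 1) =
      ((coordDiff A τ z : TopTensor A K τ) : Completion (TopTensor A K τ)) * e n := fun n => by
    have h1 := coordDiffZPow_add_one hd n
    have h2 := coordDiffZPow_add_one hd (n - 1)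
    rw [sub_add_cancel] at h2
    simp only [he, h1, coordDerivSnd_mul, coordDerivSnd_coordDiff τ hz, add_sub_cancel_right,
      add_smul, one_smul, mul_add, mul_smul_comm, ← h2, neg_mul, one_mul]
    abel
  have h0 : e 0 = 0 := by simp [he, coordDiffZPow_zero, hone]
  have hall : ∀ n, e n = 0 := fun n => by
    induction n using Int.induction_on with
    | zero => exact h0
    | succ n ih => rw [hstep, ih, mul_zero]
    | pred n ih =>
      have := hstep (-n - 1)
      rw [sub_add_cancel, ih] at this
      exact hd.mul_right_eq_zero.1 this.symm
  rw [neg_smul]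
  exact eq_neg_of_add_eq_zero_left (hall n)

end TensorCompletion

/-! ### Bilinearity and translation for the `n`-products -/

section Products

variable {A K U : Type*} [CommRing A] [CommRing K] [Algebra A K] [TopologicalSpace K]
  [IsTopologicalRing K] [IsLinearTopology A K] [Ring U] [Algebra A U]
  [UniformSpace U] [IsUniformAddGroup U] [IsTopologicalRing U] [CompleteSpace U] [T2Space U]
  [IsLinearTopology U U]

/-- The extension of `XY` to the completion of `K ⊗ K` for the right topology. -/
noncomputable def prodExt (X Y : K →L[A] U) : Completion (TopTensor A K .right) →+ U :=
  (distHom .right (prodDist X.toLinearMap Y.toLinearMap)).extension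
    (continuous_distHom_prodDist X.toLinearMap Y.continuous)

/-- The extension of `YX ∘ σ` to the completion of `K ⊗ K` for the left topology. -/
noncomputable def prodSwapExt (X Y : K →L[A] U) : Completion (TopTensor A K .left) →+ U :=
  (distHom .left (prodDistSwap X.toLinearMap Y.toLinearMap)).extension
    (continuous_distHom_prodDistSwap X.continuous Y.toLinearMap)

@[fun_prop]
theorem continuous_prodExt (X Y : K →L[A] U) : Continuous (prodExt X Y) :=
  AddMonoidHom.continuous_extension _ _

@[fun_prop]
theorem continuous_prodSwapExt (X Y : K →L[A] U) : Continuous (prodSwapExt X Y) :=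
  AddMonoidHom.continuous_extension _ _

theorem prodExt_coe (X Y : K →L[A] U) (t : TopTensor A K .right) :
    prodExt X Y t = prodDist X.toLinearMap Y.toLinearMap t :=
  AddMonoidHom.extension_coe _ _ t

theorem prodSwapExt_coe (X Y : K →L[A] U) (t : TopTensor A K .left) :
    prodSwapExt X Y t = prodDistSwap X.toLinearMap Y.toLinearMap t :=
  AddMonoidHom.extension_coe _ _ t

theorem prodExt_tmul (X Y : K →L[A] U) (a b : K) :
    prodExt X Y (TopTensor.tmul .right a b : TopTensor A K .right) = X a * Y b :=
  prodExt_coe X Y _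

theorem prodSwapExt_tmul (X Y : K →L[A] U) (a b : K) :
    prodSwapExt X Y (TopTensor.tmul .left a b : TopTensor A K .left) = Y b * X a :=
  prodSwapExt_coe X Y _

theorem nProduct_apply (z : K) (n : ℤ) (X Y : K →L[A] U) (g : K) :
    nProduct z n X Y g =
      prodExt X Y (coordDiffZPow A .right z n * (TopTensor.tmul .right 1 g : TopTensor A K .right))
        - prodSwapExt X Y
          (coordDiffZPow A .left z n * (TopTensor.tmul .left 1 g : TopTensor A K .left)) :=
  rfl

theorem prodExt_add_left (X X' Y : K →L[A] U) :
    prodExt (X + X') Y = prodExt X Y + prodExt X' Y := by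
  refine TopTensor.completion_hom_ext (by fun_prop)
    ((continuous_prodExt X Y).add (continuous_prodExt X' Y)) fun a b => ?_
  simp only [AddMonoidHom.add_apply, prodExt_tmul, add_apply, add_mul]

theorem prodExt_add_right (X Y Y' : K →L[A] U) :
    prodExt X (Y + Y') = prodExt X Y + prodExt X Y' := by
  refine TopTensor.completion_hom_ext (by fun_prop)
    ((continuous_prodExt X Y).add (continuous_prodExt X Y')) fun a b => ?_
  simp only [AddMonoidHom.add_apply, prodExt_tmul, add_apply, mul_add]

theorem prodSwapExt_add_left (X X' Y : K →L[A] U) :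
    prodSwapExt (X + X') Y = prodSwapExt X Y + prodSwapExt X' Y := by
  refine TopTensor.completion_hom_ext (by fun_prop)
    ((continuous_prodSwapExt X Y).add (continuous_prodSwapExt X' Y)) fun a b => ?_
  simp only [AddMonoidHom.add_apply, prodSwapExt_tmul, add_apply, mul_add]

theorem prodSwapExt_add_right (X Y Y' : K →L[A] U) :
    prodSwapExt X (Y + Y') = prodSwapExt X Y + prodSwapExt X Y' := by
  refine TopTensor.completion_hom_ext (by fun_prop)
    ((continuous_prodSwapExt X Y).add (continuous_prodSwapExt X Y')) fun a b => ?_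
  simp only [AddMonoidHom.add_apply, prodSwapExt_tmul, add_apply, add_mul]

theorem nProduct_add_left (z : K) (n : ℤ) (X X' Y : K →L[A] U) :
    nProduct z n (X + X') Y = nProduct z n X Y + nProduct z n X' Y := by
  ext g
  simp only [nProduct_apply, LinearMap.add_apply, prodExt_add_left, prodSwapExt_add_left,
    AddMonoidHom.add_apply]
  abel

theorem nProduct_add_right (z : K) (n : ℤ) (X Y Y' : K →L[A] U) :
    nProduct z n X (Y + Y') = nProduct z n X Y + nProduct z n X Y' := by
  ext g
  simp only [nProduct_apply, LinearMap.add_apply, prodExt_add_right, prodSwapExt_add_right,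
    AddMonoidHom.add_apply]
  abel

section Scalars

variable [Algebra ℂ U] [SMulCommClass A ℂ U]

theorem prodExt_smul_left (c : ℂ) (X Y : K →L[A] U) (x : Completion (TopTensor A K .right)) :
    prodExt (c • X) Y x = c • prodExt X Y x := by
  refine DFunLike.congr_fun (f := prodExt (c • X) Y)
    (g := (DistribSMul.toAddMonoidHom U c).comp (prodExt X Y)) ?_ x
  refine TopTensor.completion_hom_ext (by fun_prop)
    ((continuous_prodExt X Y).const_smul c) fun a b => ?_
  simp [prodExt_tmul]

theorem prodExt_smul_right (c : ℂ) (X Y : K →L[A] U) (x : Completion (TopTensor A K .right)) :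
    prodExt X (c • Y) x = c • prodExt X Y x := by
  refine DFunLike.congr_fun (f := prodExt X (c • Y))
    (g := (DistribSMul.toAddMonoidHom U c).comp (prodExt X Y)) ?_ x
  refine TopTensor.completion_hom_ext (by fun_prop)
    ((continuous_prodExt X Y).const_smul c) fun a b => ?_
  simp [prodExt_tmul]

theorem prodSwapExt_smul_left (c : ℂ) (X Y : K →L[A] U) (x : Completion (TopTensor A K .left)) :
    prodSwapExt (c • X) Y x = c • prodSwapExt X Y x := by
  refine DFunLike.congr_fun (f := prodSwapExt (c • X) Y)
    (g := (DistribSMul.toAddMonoidHom U c).comp (prodSwapExt X Y)) ?_ x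
  refine TopTensor.completion_hom_ext (by fun_prop)
    ((continuous_prodSwapExt X Y).const_smul c) fun a b => ?_
  simp [prodSwapExt_tmul]

theorem prodSwapExt_smul_right (c : ℂ) (X Y : K →L[A] U)
    (x : Completion (TopTensor A K .left)) :
    prodSwapExt X (c • Y) x = c • prodSwapExt X Y x := by
  refine DFunLike.congr_fun (f := prodSwapExt X (c • Y))
    (g := (DistribSMul.toAddMonoidHom U c).comp (prodSwapExt X Y)) ?_ x
  refine TopTensor.completion_hom_ext (by fun_prop)
    ((continuous_prodSwapExt X Y).const_smul c) fun a b => ?_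
  simp [prodSwapExt_tmul]

theorem nProduct_smul_left (z : K) (n : ℤ) (c : ℂ) (X Y : K →L[A] U) :
    nProduct z n (c • X) Y = c • nProduct z n X Y := by
  ext g
  simp only [nProduct_apply, LinearMap.smul_apply, prodExt_smul_left, prodSwapExt_smul_left,
    smul_sub]

theorem nProduct_smul_right (z : K) (n : ℤ) (c : ℂ) (X Y : K →L[A] U) :
    nProduct z n X (c • Y) = c • nProduct z n X Y := by
  ext g
  simp only [nProduct_apply, LinearMap.smul_apply, prodExt_smul_right, prodSwapExt_smul_right,
    smul_sub]

end Scalars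

/-- For `n ≥ 0` the `n`-product only involves the bracket `[X, Y]` on `K ⊗ K`. -/
theorem nProduct_natCast_apply (z : K) (n : ℕ) (X Y : K →L[A] U) (g : K) :
    nProduct z n X Y g = bracketDist X.toLinearMap Y.toLinearMap
      ((z ⊗ₜ[A] 1 - 1 ⊗ₜ[A] z) ^ n * 1 ⊗ₜ[A] g) := by
  rw [nProduct_apply, coordDiffZPow_natCast, coordDiffZPow_natCast, ← Completion.coe_mul,
    ← Completion.coe_mul, prodExt_coe, prodSwapExt_coe]
  rfl

theorem nProduct_natCast_eq_zero {z : K} {X Y : K →L[A] U} {N : ℕ}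
    (h : ∀ t : K ⊗[A] K, bracketDist X.toLinearMap Y.toLinearMap
      ((z ⊗ₜ[A] 1 - 1 ⊗ₜ[A] z) ^ N * t) = 0) {n : ℕ} (hn : N ≤ n) : nProduct z n X Y = 0 := by
  ext g
  obtain ⟨k, rfl⟩ := Nat.exists_eq_add_of_le hn
  rw [nProduct_natCast_apply, pow_add, mul_assoc, h]
  rfl

theorem fieldDeriv_apply (z : K) (X : K →L[A] U) (g : K) :
    fieldDeriv z X g = -X (coordDeriv A z g) :=
  rfl

theorem prodExt_fieldDeriv (z : K) (X Y : K →L[A] U) (x : Completion (TopTensor A K .right)) :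
    prodExt X (fieldDeriv z Y) x = -prodExt X Y (coordDerivSnd A .right z x) := by
  refine DFunLike.congr_fun (f := prodExt X (fieldDeriv z Y))
    (g := -(prodExt X Y).comp (coordDerivSnd A .right z)) ?_ x
  refine TopTensor.completion_hom_ext (by fun_prop)
    ((continuous_prodExt X Y).comp (continuous_coordDerivSnd .right z)).neg fun a b => ?_
  simp only [prodExt_tmul, AddMonoidHom.neg_apply, AddMonoidHom.comp_apply, coordDerivSnd_tmul,
    fieldDeriv_apply, mul_neg]

theorem prodSwapExt_fieldDeriv (z : K) (X Y : K →L[A] U)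
    (x : Completion (TopTensor A K .left)) :
    prodSwapExt X (fieldDeriv z Y) x = -prodSwapExt X Y (coordDerivSnd A .left z x) := by
  refine DFunLike.congr_fun (f := prodSwapExt X (fieldDeriv z Y))
    (g := -(prodSwapExt X Y).comp (coordDerivSnd A .left z)) ?_ x
  refine TopTensor.completion_hom_ext (by fun_prop)
    ((continuous_prodSwapExt X Y).comp (continuous_coordDerivSnd .left z)).neg fun a b => ?_
  simp only [prodSwapExt_tmul, AddMonoidHom.neg_apply, AddMonoidHom.comp_apply,
    coordDerivSnd_tmul, fieldDeriv_apply, neg_mul]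

/-- `∂ (X_(n) Y) - X_(n) (∂ Y) = - n X_(n-1) Y`: integration by parts in the second variable, on
which the test function depends. -/
theorem nProduct_translation {z : K}
    (hl : IsUnit ((coordDiff A .left z : TopTensor A K .left) : Completion (TopTensor A K .left)))
    (hr : IsUnit ((coordDiff A .right z : TopTensor A K .right) :
      Completion (TopTensor A K .right)))
    (hz : coordDeriv A z z = 1) (X Y : K →L[A] U) (n : ℤ) (g : K) :
    -nProduct z n X Y (coordDeriv A z g) - nProduct z n X (fieldDeriv z Y) g =
      (-n) • nProduct z (n - 1) X Y g := by
  simp only [nProduct_apply, prodExt_fieldDeriv, prodSwapExt_fieldDeriv, coordDerivSnd_mul,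
    coordDerivSnd_coordDiffZPow hl hz, coordDerivSnd_coordDiffZPow hr hz, coordDerivSnd_tmul,
    map_add, smul_mul_assoc, map_zsmul, smul_sub]
  abel

end Products

/-! ### Changing the topology and exchanging the factors -/

section TopologyChange

variable {A K : Type*} [CommRing A] [CommRing K] [Algebra A K] [TopologicalSpace K]
  [IsTopologicalRing K] [IsLinearTopology A K]

/-- The identity of `K ⊗ K`, from the middle topology to another topology `τ`. -/
def TopTensor.ofMiddle (τ : TensorTopology) : TopTensor A K .middle →+* TopTensor A K τ :=
  RingHom.id (K ⊗[A] K)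

theorem TopTensor.continuous_ofMiddle (τ : TensorTopology) :
    Continuous (TopTensor.ofMiddle (A := A) (K := K) τ) := by
  refine continuous_of_continuousAt_zero (TopTensor.ofMiddle (A := A) (K := K) τ) ?_
  rw [ContinuousAt, map_zero]
  refine (TopTensor.hasBasis_nhds_zero .middle).tendsto_iff (TopTensor.hasBasis_nhds_zero τ) |>.2 ?_
  rintro ⟨⟨M, N⟩, hM, hN⟩ -
  have hM' : TensorTopology.middle.fst M := by
    cases τ
    · exact hM
    · exact hM
    · rw [show M = ⊤ from hM]; exact isOpen_univ
  have hN' : TensorTopology.middle.snd N := by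
    cases τ
    · exact hN
    · rw [show N = ⊤ from hN]; exact isOpen_univ
    · exact hN
  exact ⟨⟨(M, N), hM', hN'⟩, trivial, fun t ht => ht⟩

/-- The exchange of the two factors, as a map from `K ⊗ K` with the topology `τ` to `K ⊗ K` with
the topology `τ'`. -/
def TopTensor.swapHom (τ τ' : TensorTopology) : TopTensor A K τ →+ TopTensor A K τ' :=
  (TensorProduct.comm A K K).toLinearMap.toAddMonoidHom

theorem TopTensor.swapHom_tmul (τ τ' : TensorTopology) (a b : K) :
    TopTensor.swapHom (A := A) τ τ' (TopTensor.tmul τ a b) = TopTensor.tmul τ' b a :=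
  TensorProduct.comm_tmul A K K a b

theorem TopTensor.continuous_swapHom {τ τ' : TensorTopology}
    (h₁ : ∀ M : Submodule A K, τ'.fst M → τ.snd M)
    (h₂ : ∀ M : Submodule A K, τ'.snd M → τ.fst M) :
    Continuous (TopTensor.swapHom (A := A) (K := K) τ τ') := by
  refine continuous_of_continuousAt_zero (TopTensor.swapHom (A := A) (K := K) τ τ') ?_
  rw [ContinuousAt, map_zero]
  refine (TopTensor.hasBasis_nhds_zero τ).tendsto_iff (TopTensor.hasBasis_nhds_zero τ') |>.2 ?_
  rintro ⟨⟨M, N⟩, hM, hN⟩ -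
  refine ⟨⟨(N, M), h₂ N hN, h₁ M hM⟩, trivial, ?_⟩
  have h : tensorSubmodule N M ≤
      (tensorSubmodule M N).comap (TensorProduct.comm A K K).toLinearMap :=
    tensorSubmodule_le_iff.2 fun x hx y hy => tmul_mem_tensorSubmodule hy hx
  exact fun t ht => h ht

variable {τ τ' : TensorTopology} (hc : Continuous (TopTensor.swapHom (A := A) (K := K) τ τ'))

theorem completion_swapHom_coordDiff_mul (z : K) (x : Completion (TopTensor A K τ)) :
    (TopTensor.swapHom τ τ').completion hc ((coordDiff A τ z : TopTensor A K τ) * x) =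
      -((coordDiff A τ' z : TopTensor A K τ') * (TopTensor.swapHom τ τ').completion hc x) := by
  set s := (TopTensor.swapHom τ τ').completion hc with hs
  have hsc : Continuous s := AddMonoidHom.continuous_completion _ hc
  refine DFunLike.congr_fun (f := s.comp (AddMonoidHom.mulLeft _))
    (g := -(AddMonoidHom.mulLeft ((coordDiff A τ' z : TopTensor A K τ') :
      Completion (TopTensor A K τ'))).comp s) ?_ x
  refine TopTensor.completion_hom_ext (hsc.comp (continuous_const_mul _))
    ((continuous_const_mul _).comp hsc).neg fun a b => ?_
  simp only [AddMonoidHom.comp_apply, AddMonoidHom.coe_mulLeft, AddMonoidHom.neg_apply, hs,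
    ← Completion.coe_mul, AddMonoidHom.completion_coe, ← Completion.coe_neg, coordDiff, sub_mul,
    TopTensor.tmul_mul_tmul, map_sub, TopTensor.swapHom_tmul, one_mul, neg_sub]

/-- The exchange of the factors maps `(z - w)⁻¹ (1 ⊗ g)` to `- (z - w)⁻¹ (g ⊗ 1)`. -/
theorem completion_swapHom_coordDiffZPow_neg_one_mul {z : K}
    (hd : IsUnit ((coordDiff A τ z : TopTensor A K τ) : Completion (TopTensor A K τ)))
    (hd' : IsUnit ((coordDiff A τ' z : TopTensor A K τ') : Completion (TopTensor A K τ'))) (g : K) :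
    (TopTensor.swapHom τ τ').completion hc
        (coordDiffZPow A τ z (-1) * (TopTensor.tmul τ 1 g : TopTensor A K τ)) =
      -(coordDiffZPow A τ' z (-1) * (TopTensor.tmul τ' g 1 : TopTensor A K τ')) := by
  have h1 := coordDiffZPow_add_one hd (-1)
  have h2 := coordDiffZPow_add_one hd' (-1)
  rw [neg_add_cancel, coordDiffZPow_zero] at h1 h2
  have h3 := completion_swapHom_coordDiff_mul hc z
    (coordDiffZPow A τ z (-1) * (TopTensor.tmul τ 1 g : TopTensor A K τ))
  rw [← mul_assoc, ← h1, one_mul, AddMonoidHom.completion_coe, TopTensor.swapHom_tmul] at h3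
  refine hd'.mul_left_cancel ?_
  rw [mul_neg, ← mul_assoc, ← h2, one_mul, h3, neg_neg]

end TopologyChange

/-! ### Commuting fields -/

section Central

variable {A K U : Type*} [CommRing A] [CommRing K] [Algebra A K] [TopologicalSpace K]
  [IsTopologicalRing K] [IsLinearTopology A K] [Ring U] [Algebra A U]
  [UniformSpace U] [IsUniformAddGroup U] [IsTopologicalRing U] [CompleteSpace U] [T2Space U]
  [IsLinearTopology U U]

/-- `Y_(-1) X` is given by the expression for `X_(-1) Y`, evaluated at `g ⊗ 1` instead of `1 ⊗ g`:
the exchange of the factors changes the sign of `z - w`. -/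
theorem nProduct_neg_one_swap {z : K}
    (hl : IsUnit ((coordDiff A .left z : TopTensor A K .left) : Completion (TopTensor A K .left)))
    (hr : IsUnit ((coordDiff A .right z : TopTensor A K .right) :
      Completion (TopTensor A K .right))) (X Y : K →L[A] U) (g : K) :
    nProduct z (-1) Y X g =
      prodExt X Y
          (coordDiffZPow A .right z (-1) * (TopTensor.tmul .right g 1 : TopTensor A K .right)) -
        prodSwapExt X Y
          (coordDiffZPow A .left z (-1) * (TopTensor.tmul .left g 1 : TopTensor A K .left)) := by
  have hrl : Continuous (TopTensor.swapHom (A := A) (K := K) .right .left) :=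
    TopTensor.continuous_swapHom (fun _ h => h) fun _ h => h
  have hlr : Continuous (TopTensor.swapHom (A := A) (K := K) .left .right) :=
    TopTensor.continuous_swapHom (fun _ h => h) fun _ h => h
  have h1 : prodExt Y X =
      (prodSwapExt X Y).comp ((TopTensor.swapHom .right .left).completion hrl) := by
    refine TopTensor.completion_hom_ext (by fun_prop)
      ((continuous_prodSwapExt X Y).comp (AddMonoidHom.continuous_completion _ hrl)) fun a b => ?_
    rw [AddMonoidHom.comp_apply, AddMonoidHom.completion_coe, TopTensor.swapHom_tmul,
      prodSwapExt_tmul, prodExt_tmul]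
  have h2 : prodSwapExt Y X =
      (prodExt X Y).comp ((TopTensor.swapHom .left .right).completion hlr) := by
    refine TopTensor.completion_hom_ext (by fun_prop)
      ((continuous_prodExt X Y).comp (AddMonoidHom.continuous_completion _ hlr)) fun a b => ?_
    rw [AddMonoidHom.comp_apply, AddMonoidHom.completion_coe, TopTensor.swapHom_tmul,
      prodSwapExt_tmul, prodExt_tmul]
  rw [nProduct_apply, h1, h2, AddMonoidHom.comp_apply, AddMonoidHom.comp_apply,
    completion_swapHom_coordDiffZPow_neg_one_mul hrl hr hl,
    completion_swapHom_coordDiffZPow_neg_one_mul hlr hl hr, map_neg, map_neg]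
  abel

/-- Commuting fields satisfy `X_(-1) Y = Y_(-1) X`. The difference is the value on `g ⊗ 1 - 1 ⊗ g`
of a map which is continuous for the middle topology and vanishes on the multiples of `z - w`. -/
theorem nProduct_neg_one_comm {z : K}
    (hl : IsUnit ((coordDiff A .left z : TopTensor A K .left) : Completion (TopTensor A K .left)))
    (hr : IsUnit ((coordDiff A .right z : TopTensor A K .right) :
      Completion (TopTensor A K .right)))
    (hdiag : diagonalSubring A z = ⊤) {X Y : K →L[A] U}
    (hXY : bracketDist X.toLinearMap Y.toLinearMap = 0) :
    nProduct z (-1) X Y = nProduct z (-1) Y X := by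
  ext g
  -- `Ψ = (z - w)⁻¹ XY - (z - w)⁻¹ (YX ∘ σ)`, each inverse being taken in its own completion.
  let Ψ : TopTensor A K .middle →+ U :=
    ((prodExt X Y).comp ((AddMonoidHom.mulLeft (coordDiffZPow A .right z (-1))).comp
      (Completion.toCompl.comp (TopTensor.ofMiddle .right).toAddMonoidHom))) -
    ((prodSwapExt X Y).comp ((AddMonoidHom.mulLeft (coordDiffZPow A .left z (-1))).comp
      (Completion.toCompl.comp (TopTensor.ofMiddle .left).toAddMonoidHom)))
  have hΨ : ∀ t : TopTensor A K .middle, Ψ t =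
      prodExt X Y (coordDiffZPow A .right z (-1) *
        (TopTensor.ofMiddle .right t : TopTensor A K .right)) -
      prodSwapExt X Y (coordDiffZPow A .left z (-1) *
        (TopTensor.ofMiddle .left t : TopTensor A K .left)) :=
    fun t => rfl
  have hcont : Continuous Ψ := by
    refine ((continuous_prodExt X Y).comp ((continuous_const_mul _).comp
      ((Completion.continuous_coe _).comp (TopTensor.continuous_ofMiddle .right)))).sub
      ((continuous_prodSwapExt X Y).comp ((continuous_const_mul _).comp
      ((Completion.continuous_coe _).comp (TopTensor.continuous_ofMiddle .left))))
  have hspan : ∀ t ∈ (Ideal.span {coordDiff A .middle z} : Set (TopTensor A K .middle)),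
      Ψ t = 0 := by
    intro t ht
    obtain ⟨s, rfl⟩ := Ideal.mem_span_singleton'.1 ht
    have hinv : ∀ {τ : TensorTopology},
        IsUnit ((coordDiff A τ z : TopTensor A K τ) : Completion (TopTensor A K τ)) →
        coordDiffZPow A τ z (-1) *
          (TopTensor.ofMiddle τ (s * coordDiff A .middle z) : TopTensor A K τ) =
        (TopTensor.ofMiddle τ s : TopTensor A K τ) := fun {τ} hd => by
      have h1 := coordDiffZPow_add_one hd (-1)
      rw [neg_add_cancel, coordDiffZPow_zero] at h1
      have h2 : TopTensor.ofMiddle τ (coordDiff A .middle z) = coordDiff A τ z := rfl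
      rw [map_mul, Completion.coe_mul, mul_left_comm, mul_comm (coordDiffZPow A τ z (-1)), h2,
        ← h1, mul_one]
    rw [hΨ, hinv hr, hinv hl, prodExt_coe, prodSwapExt_coe]
    exact DFunLike.congr_fun hXY s
  have hmem : g ∈ diagonalSubring A z := hdiag ▸ Subring.mem_top g
  have h0 : Ψ (TopTensor.tmul .middle g 1 - TopTensor.tmul .middle 1 g) = 0 :=
    closure_minimal (t := Ψ ⁻¹' {0}) (fun t ht => hspan t ht)
      (isClosed_singleton.preimage hcont) (mem_diagonalSubring.1 hmem)
  rw [map_sub, sub_eq_zero] at h0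
  rw [nProduct_neg_one_swap hl hr X Y]
  exact h0.symm

theorem bracketDist_eq_zero_of_commute {X Y : K →ₗ[A] U} (h : ∀ a b, X a * Y b = Y b * X a) :
    bracketDist X Y = 0 := by
  ext a b
  simp [bracketDist, prodDistSwap, prodDist, h]

end Central

/-! ### Multiplication by `x - y` -/

section MulXSubY

variable {M M' : Type*} [AddCommGroup M] [AddCommGroup M']

theorem mulXSubY_iterate_add (N : ℕ) (Φ Ψ : ℤ → ℤ → M) :
    mulXSubY^[N] (Φ + Ψ) = mulXSubY^[N] Φ + mulXSubY^[N] Ψ := by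
  induction N generalizing Φ Ψ with
  | zero => rfl
  | succ N ih =>
    simp only [Function.iterate_succ_apply, ← ih]
    congr 1
    funext m n
    simp only [mulXSubY, Pi.add_apply]
    abel

theorem map_mulXSubY_iterate (f : M →+ M') (N : ℕ) (Φ : ℤ → ℤ → M) (m n : ℤ) :
    f (mulXSubY^[N] Φ m n) = mulXSubY^[N] (fun m n => f (Φ m n)) m n := by
  induction N generalizing Φ with
  | zero => rfl
  | succ N ih =>
    have h : (fun m n => f (mulXSubY Φ m n)) = mulXSubY fun m n => f (Φ m n) := by
      funext m n
      simp only [mulXSubY, map_sub]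
    rw [Function.iterate_succ_apply, ih, h, Function.iterate_succ_apply]

end MulXSubY

/-! ### Biadditive maps on completions -/

section Bilinear

/-- A continuous biadditive map to a complete separated group extends to the completions. -/
theorem exists_completion_extension₂ {G H U : Type*} [AddCommGroup G] [UniformSpace G]
    [IsUniformAddGroup G] [AddCommGroup H] [UniformSpace H] [IsUniformAddGroup H]
    [AddCommGroup U] [UniformSpace U] [IsUniformAddGroup U] [CompleteSpace U] [T2Space U]
    (B : G →+ H →+ U) (hB : Continuous fun p : G × H => B p.1 p.2) :
    ∃ Φ : Completion G →+ Completion H →+ U,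
      (Continuous fun p : Completion G × Completion H => Φ p.1 p.2) ∧
        ∀ (x : G) (y : H), Φ x y = B x y := by
  have dG := Completion.isDenseInducing_toCompl G
  have dH := Completion.isDenseInducing_toCompl H
  set Φ := (dG.prodMap dH).extend fun p : G × H => B p.1 p.2
  have hΦ : Continuous Φ := dG.extend_Z_bilin dH hB
  have hcoe : ∀ (x : G) (y : H), Φ (x, y) = B x y := fun x y =>
    (dG.prodMap dH).extend_eq hB (x, y)
  have hadd₂ : ∀ (x : Completion G) (y y' : Completion H),
      Φ (x, y + y') = Φ (x, y) + Φ (x, y') := fun x y y' => by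
    induction x, y, y' using Completion.induction_on₃ with
    | hp => exact isClosed_eq (by fun_prop) (by fun_prop)
    | ih x y y' => rw [← Completion.coe_add, hcoe, hcoe, hcoe, map_add]
  have hadd₁ : ∀ (x x' : Completion G) (y : Completion H),
      Φ (x + x', y) = Φ (x, y) + Φ (x', y) := fun x x' y => by
    induction x, x', y using Completion.induction_on₃ with
    | hp => exact isClosed_eq (by fun_prop) (by fun_prop)
    | ih x x' y => rw [← Completion.coe_add, hcoe, hcoe, hcoe, map_add, AddMonoidHom.add_apply]
  exact ⟨AddMonoidHom.mk' (fun x => AddMonoidHom.mk' (fun y => Φ (x, y)) (hadd₂ x))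
    fun x x' => AddMonoidHom.ext fun y => hadd₁ x x' y, hΦ, hcoe⟩

end Bilinear

/-! ### Triple products of fields -/

section TripleProducts

variable {A K U : Type*} [CommRing A] [CommRing K] [Algebra A K] [TopologicalSpace K]
  [IsTopologicalRing K] [IsLinearTopology A K] [Ring U] [Algebra A U]

variable (A) in
/-- The bilinear map `(a ⊗ b, c ⊗ e) ↦ (a ⊗ c) ⊗ b e g`: the elements `a ⊗ b` and `c ⊗ e` of
`K ⊗ K` are placed in the factors `(1, 3)` and `(2, 3)` of `K ⊗ K ⊗ K`. -/
noncomputable def tripleMul (g : K) : K ⊗[A] K →ₗ[A] K ⊗[A] K →ₗ[A] (K ⊗[A] K) ⊗[A] K :=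
  (TensorProduct.mk A (K ⊗[A] K) (K ⊗[A] K)).compr₂
    (TensorProduct.map LinearMap.id (LinearMap.mulRight A g ∘ₗ LinearMap.mul' A K) ∘ₗ
      (TensorProduct.tensorTensorTensorComm A K K K K).toLinearMap)

theorem tripleMul_tmul_tmul (g a b c e : K) :
    tripleMul A g (a ⊗ₜ b) (c ⊗ₜ e) = (a ⊗ₜ c) ⊗ₜ (b * e * g) := by
  simp [tripleMul]

/-- The biadditive map `(a ⊗ b, c ⊗ e) ↦ P((a ⊗ c) ⊗ b e g)`. -/
noncomputable def tripleHom (τ τ' : TensorTopology) (P : (K ⊗[A] K) ⊗[A] K →ₗ[A] U) (g : K) :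
    TopTensor A K τ →+ TopTensor A K τ' →+ U :=
  AddMonoidHom.mk' (fun α => (P ∘ₗ tripleMul A g α).toAddMonoidHom) fun α α' =>
    AddMonoidHom.ext fun β => by
      have : ∀ s s' t : K ⊗[A] K,
          P (tripleMul A g (s + s') t) = P (tripleMul A g s t) + P (tripleMul A g s' t) :=
        fun s s' t => by rw [map_add, LinearMap.add_apply, map_add]
      exact this α α' β

theorem tripleHom_tmul_tmul (τ τ' : TensorTopology) (P : (K ⊗[A] K) ⊗[A] K →ₗ[A] U)
    (g a b c e : K) :
    tripleHom τ τ' P g (TopTensor.tmul τ a b) (TopTensor.tmul τ' c e) =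
      P ((a ⊗ₜ c) ⊗ₜ (b * e * g)) :=
  congrArg P (tripleMul_tmul_tmul g a b c e)

variable [UniformSpace U] [IsUniformAddGroup U] [IsTopologicalRing U] [IsLinearTopology U U]

theorem TopTensor.map_mem_of_mem_tensorSubmodule {τ : TensorTopology} (f : TopTensor A K τ →+ U)
    (J : AddSubgroup U) {M N : Submodule A K}
    (h : ∀ a ∈ M, ∀ b ∈ N, f (TopTensor.tmul τ a b) ∈ J) (t : TopTensor A K τ)
    (ht : t ∈ tensorSubmodule M N) : f t ∈ J := by
  obtain ⟨s, rfl⟩ := ht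
  induction s with
  | zero =>
    rw [map_zero]
    exact (map_zero f).symm ▸ J.zero_mem
  | tmul a b => exact h _ a.2 _ b.2
  | add s t hs ht =>
    rw [map_add]
    exact (map_add f _ _).symm ▸ J.add_mem hs ht

theorem TopTensor.continuousAt_zero {τ : TensorTopology} {f : TopTensor A K τ →+ U}
    (h : ∀ J : Ideal U, IsOpen (J : Set U) → ∃ i : TensorIndex A K τ, ∀ a ∈ i.1.1, ∀ b ∈ i.1.2,
      f (TopTensor.tmul τ a b) ∈ J) : ContinuousAt f 0 := by
  rw [ContinuousAt, map_zero]
  intro s hs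
  rw [Filter.mem_map]
  obtain ⟨J, hJ, hJs⟩ := exists_open_left_ideal_le hs
  obtain ⟨i, hi⟩ := h J hJ
  refine Filter.mem_of_superset ((TopTensor.hasBasis_nhds_zero τ).mem_of_mem (i := i) trivial) ?_
  exact fun t ht => hJs (TopTensor.map_mem_of_mem_tensorSubmodule f J.toAddSubgroup hi t ht)

/-- A biadditive map is continuous if it is so, jointly and separately, at `0`; this is tested on
pure tensors and open left ideals. -/
theorem TopTensor.continuous_bilin {τ τ' : TensorTopology}
    (B : TopTensor A K τ →+ TopTensor A K τ' →+ U)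
    (h0 : ∀ J : Ideal U, IsOpen (J : Set U) → ∃ (i : TensorIndex A K τ) (j : TensorIndex A K τ'),
      ∀ a ∈ i.1.1, ∀ b ∈ i.1.2, ∀ c ∈ j.1.1, ∀ e ∈ j.1.2,
        B (TopTensor.tmul τ a b) (TopTensor.tmul τ' c e) ∈ J)
    (h1 : ∀ J : Ideal U, IsOpen (J : Set U) → ∀ a b, ∃ j : TensorIndex A K τ',
      ∀ c ∈ j.1.1, ∀ e ∈ j.1.2, B (TopTensor.tmul τ a b) (TopTensor.tmul τ' c e) ∈ J)
    (h2 : ∀ J : Ideal U, IsOpen (J : Set U) → ∀ c e, ∃ i : TensorIndex A K τ,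
      ∀ a ∈ i.1.1, ∀ b ∈ i.1.2, B (TopTensor.tmul τ a b) (TopTensor.tmul τ' c e) ∈ J) :
    Continuous fun p : TopTensor A K τ × TopTensor A K τ' => B p.1 p.2 := by
  refine continuous_of_continuousAt_zero₂ B ?_ ?_ ?_
  · have h00 : B 0 0 = 0 := map_zero (B 0)
    rw [ContinuousAt, h00, nhds_prod_eq]
    intro s hs
    rw [Filter.mem_map]
    obtain ⟨J, hJ, hJs⟩ := exists_open_left_ideal_le hs
    obtain ⟨i, j, hij⟩ := h0 J hJ
    refine Filter.mem_of_superset (Filter.prod_mem_prod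
      ((TopTensor.hasBasis_nhds_zero τ).mem_of_mem (i := i) trivial)
      ((TopTensor.hasBasis_nhds_zero τ').mem_of_mem (i := j) trivial)) ?_
    rintro ⟨x, y⟩ ⟨hx, hy⟩
    refine hJs ?_
    refine TopTensor.map_mem_of_mem_tensorSubmodule (B.flip y) J.toAddSubgroup
      (fun a ha b hb => ?_) x hx
    exact TopTensor.map_mem_of_mem_tensorSubmodule (B (TopTensor.tmul τ a b)) J.toAddSubgroup
      (fun c hc e he => hij a ha b hb c hc e he) y hy
  · have key : ∀ s : K ⊗[A] K, ContinuousAt (B s) 0 := fun s => by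
      induction s with
      | zero =>
        have : B (0 : K ⊗[A] K) = 0 := map_zero B
        rw [this]
        exact continuousAt_const
      | tmul a b => exact TopTensor.continuousAt_zero fun J hJ => h1 J hJ a b
      | add s t hs ht =>
        have : B (s + t : K ⊗[A] K) = B s + B t := map_add B s t
        rw [this]
        exact hs.add ht
    exact key
  · have key : ∀ s : K ⊗[A] K, ContinuousAt (B.flip s) 0 := fun s => by
      induction s with
      | zero =>
        have : B.flip (0 : K ⊗[A] K) = 0 := map_zero B.flip
        rw [this]
        exact continuousAt_const
      | tmul a b => exact TopTensor.continuousAt_zero fun J hJ => h2 J hJ a b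
      | add s t hs ht =>
        have : B.flip (s + t : K ⊗[A] K) = B.flip s + B.flip t := map_add B.flip s t
        rw [this]
        exact hs.add ht
    exact key

variable [CompleteSpace U] [T2Space U]

/-- `(a ⊗ b, c ⊗ e) ↦ Q(a ⊗ c) Z(b e g)` is continuous for the right topologies. -/
theorem exists_tripleExt_right_right (Q : K ⊗[A] K →ₗ[A] U) (Z : K →L[A] U) (g : K) :
    ∃ Φ : Completion (TopTensor A K .right) →+ Completion (TopTensor A K .right) →+ U,
      (Continuous fun p : Completion (TopTensor A K .right) × Completion (TopTensor A K .right) =>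
        Φ p.1 p.2) ∧
      ∀ a b c e, Φ (TopTensor.tmul .right a b : TopTensor A K .right)
        (TopTensor.tmul .right c e : TopTensor A K .right) = Q (a ⊗ₜ c) * Z (b * e * g) := by
  set B := tripleHom .right .right (LinearMap.mul' A U ∘ₗ TensorProduct.map Q Z.toLinearMap) g
  have hB : ∀ a b c e, B (TopTensor.tmul .right a b) (TopTensor.tmul .right c e) =
      Q (a ⊗ₜ c) * Z (b * e * g) := fun a b c e => by
    rw [tripleHom_tmul_tmul]
    simp
  suffices hcont : Continuous fun p : TopTensor A K .right × TopTensor A K .right => B p.1 p.2 by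
    obtain ⟨Φ, hΦ, h⟩ := exists_completion_extension₂ B hcont
    exact ⟨Φ, hΦ, fun a b c e => by rw [h, hB]⟩
  refine TopTensor.continuous_bilin B ?_ ?_ ?_
  all_goals
    intro J hJ
    obtain ⟨M, hM, hMJ⟩ := exists_open_submodule_map_mem (X := Z.toLinearMap) Z.continuous hJ
  · obtain ⟨M₁, hM₁, h₁⟩ := exists_open_const_mul_mem hM g
    obtain ⟨M₂, hM₂, h₂⟩ := exists_open_mul_mem hM₁
    refine ⟨⟨(⊤, M₂), rfl, hM₂⟩, ⟨(⊤, M₂), rfl, hM₂⟩, fun a _ b hb c _ e he => ?_⟩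
    rw [hB]
    refine J.mul_mem_left _ (hMJ _ ?_)
    rw [mul_comm]
    exact h₁ _ (h₂ b hb e he)
  · intro a b
    obtain ⟨M₁, hM₁, h₁⟩ := exists_open_const_mul_mem hM (b * g)
    refine ⟨⟨(⊤, M₁), rfl, hM₁⟩, fun c _ e he => ?_⟩
    rw [hB]
    refine J.mul_mem_left _ (hMJ _ ?_)
    rw [mul_right_comm]
    exact h₁ e he
  · intro c e
    obtain ⟨M₁, hM₁, h₁⟩ := exists_open_const_mul_mem hM (e * g)
    refine ⟨⟨(⊤, M₁), rfl, hM₁⟩, fun a _ b hb => ?_⟩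
    rw [hB]
    refine J.mul_mem_left _ (hMJ _ ?_)
    rw [mul_assoc, mul_comm]
    exact h₁ b hb

/-- If `Q` is jointly continuous, `(a ⊗ b, c ⊗ e) ↦ Z(b e g) Q(a ⊗ c)` is continuous for the left
topologies. -/
theorem exists_tripleExt_left_left (Q : K ⊗[A] K →ₗ[A] U)
    (hQ : Continuous fun p : K × K => Q (p.1 ⊗ₜ p.2)) (Z : K →L[A] U) (g : K) :
    ∃ Φ : Completion (TopTensor A K .left) →+ Completion (TopTensor A K .left) →+ U,
      (Continuous fun p : Completion (TopTensor A K .left) × Completion (TopTensor A K .left) =>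
        Φ p.1 p.2) ∧
      ∀ a b c e, Φ (TopTensor.tmul .left a b : TopTensor A K .left)
        (TopTensor.tmul .left c e : TopTensor A K .left) = Z (b * e * g) * Q (a ⊗ₜ c) := by
  set B := tripleHom .left .left (LinearMap.mul' A U ∘ₗ TensorProduct.map Z.toLinearMap Q ∘ₗ
    (TensorProduct.comm A (K ⊗[A] K) K).toLinearMap) g
  have hB : ∀ a b c e, B (TopTensor.tmul .left a b) (TopTensor.tmul .left c e) =
      Z (b * e * g) * Q (a ⊗ₜ c) := fun a b c e => by
    rw [tripleHom_tmul_tmul]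
    simp
  suffices hcont : Continuous fun p : TopTensor A K .left × TopTensor A K .left => B p.1 p.2 by
    obtain ⟨Φ, hΦ, h⟩ := exists_completion_extension₂ B hcont
    exact ⟨Φ, hΦ, fun a b c e => by rw [h, hB]⟩
  refine TopTensor.continuous_bilin B ?_ ?_ ?_
  · intro J hJ
    have hnhds : (fun p : K × K => Q (p.1 ⊗ₜ p.2)) ⁻¹' J ∈ 𝓝 ((0 : K), (0 : K)) :=
      hQ.continuousAt.preimage_mem_nhds (by simpa using hJ.mem_nhds J.zero_mem)
    rw [nhds_prod_eq, Filter.mem_prod_self_iff] at hnhds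
    obtain ⟨t, ht, hsub⟩ := hnhds
    obtain ⟨M, hM, hle⟩ := exists_open_submodule_le (A := A) ht
    refine ⟨⟨(M, ⊤), hM, rfl⟩, ⟨(M, ⊤), hM, rfl⟩, fun a ha b _ c hc e _ => ?_⟩
    rw [hB]
    exact J.mul_mem_left _ (hsub (Set.mk_mem_prod (hle ha) (hle hc)))
  · intro J hJ a b
    have hc : Continuous (Q ∘ₗ TensorProduct.mk A K K a) := hQ.comp (Continuous.prodMk_right a)
    obtain ⟨M, hM, hMJ⟩ := exists_open_submodule_map_mem hc hJ
    refine ⟨⟨(M, ⊤), hM, rfl⟩, fun c hc e _ => ?_⟩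
    rw [hB]
    exact J.mul_mem_left _ (hMJ c hc)
  · intro J hJ c e
    have hc : Continuous (Q ∘ₗ (TensorProduct.mk A K K).flip c) :=
      hQ.comp (Continuous.prodMk_left c)
    obtain ⟨M, hM, hMJ⟩ := exists_open_submodule_map_mem hc hJ
    refine ⟨⟨(M, ⊤), hM, rfl⟩, fun a ha b _ => ?_⟩
    rw [hB]
    exact J.mul_mem_left _ (hMJ a ha)

/-- `(a ⊗ b, c ⊗ e) ↦ X(a) Z(b e g) Y(c)` is continuous for the right topology in the first variable
and the left topology in the second one. -/
theorem exists_tripleExt_right_left (X Z Y : K →L[A] U) (g : K) :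
    ∃ Φ : Completion (TopTensor A K .right) →+ Completion (TopTensor A K .left) →+ U,
      (Continuous fun p : Completion (TopTensor A K .right) × Completion (TopTensor A K .left) =>
        Φ p.1 p.2) ∧
      ∀ a b c e, Φ (TopTensor.tmul .right a b : TopTensor A K .right)
        (TopTensor.tmul .left c e : TopTensor A K .left) = X a * Z (b * e * g) * Y c := by
  set B := tripleHom .right .left (LinearMap.mul' A U ∘ₗ
    TensorProduct.map (prodDist X.toLinearMap Z.toLinearMap) Y.toLinearMap ∘ₗ
    (TensorProduct.rightComm A K K K).toLinearMap) g
  have hB : ∀ a b c e, B (TopTensor.tmul .right a b) (TopTensor.tmul .left c e) =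
      X a * Z (b * e * g) * Y c := fun a b c e => by
    rw [tripleHom_tmul_tmul]
    simp [prodDist]
  suffices hcont : Continuous fun p : TopTensor A K .right × TopTensor A K .left => B p.1 p.2 by
    obtain ⟨Φ, hΦ, h⟩ := exists_completion_extension₂ B hcont
    exact ⟨Φ, hΦ, fun a b c e => by rw [h, hB]⟩
  refine TopTensor.continuous_bilin B ?_ ?_ ?_
  · intro J hJ
    obtain ⟨M, hM, hMJ⟩ := exists_open_submodule_map_mem (X := Y.toLinearMap) Y.continuous hJ
    refine ⟨⟨(⊤, ⊤), rfl, isOpen_univ⟩, ⟨(M, ⊤), hM, rfl⟩, fun a _ b _ c hc e _ => ?_⟩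
    rw [hB]
    exact J.mul_mem_left _ (hMJ c hc)
  · intro J hJ a b
    obtain ⟨M, hM, hMJ⟩ := exists_open_submodule_map_mem (X := Y.toLinearMap) Y.continuous hJ
    refine ⟨⟨(M, ⊤), hM, rfl⟩, fun c hc e _ => ?_⟩
    rw [hB]
    exact J.mul_mem_left _ (hMJ c hc)
  · intro J hJ c e
    have hc : Continuous
        (LinearMap.mulRight A (Y c) ∘ₗ Z.toLinearMap ∘ₗ LinearMap.mulLeft A (e * g)) :=
      (continuous_mul_const _).comp (Z.continuous.comp (continuous_const_mul _))
    obtain ⟨M, hM, hMJ⟩ := exists_open_submodule_map_mem hc hJ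
    refine ⟨⟨(⊤, M), rfl, hM⟩, fun a _ b hb => ?_⟩
    have := hMJ b hb
    rw [LinearMap.comp_apply, LinearMap.comp_apply, LinearMap.mulLeft_apply,
      LinearMap.mulRight_apply, mul_comm, ← mul_assoc] at this
    rw [hB, mul_assoc]
    exact J.mul_mem_left _ this

/-- `(a ⊗ b, c ⊗ e) ↦ Y(c) Z(b e g) X(a)` is continuous for the left topology in the first variable
and the right topology in the second one. -/
theorem exists_tripleExt_left_right (Y Z X : K →L[A] U) (g : K) :
    ∃ Φ : Completion (TopTensor A K .left) →+ Completion (TopTensor A K .right) →+ U,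
      (Continuous fun p : Completion (TopTensor A K .left) × Completion (TopTensor A K .right) =>
        Φ p.1 p.2) ∧
      ∀ a b c e, Φ (TopTensor.tmul .left a b : TopTensor A K .left)
        (TopTensor.tmul .right c e : TopTensor A K .right) = Y c * Z (b * e * g) * X a := by
  obtain ⟨Φ, hΦ, h⟩ := exists_tripleExt_right_left Y Z X g
  refine ⟨Φ.flip, hΦ.comp continuous_swap, fun a b c e => ?_⟩
  rw [AddMonoidHom.flip_apply, h, mul_comm e b]

end TripleProducts

/-! ### Locality of the `n`-products -/

section Locality

variable {A K U : Type*} [CommRing A] [CommRing K] [Algebra A K] [TopologicalSpace K]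
  [IsTopologicalRing K] [IsLinearTopology A K] [Ring U] [Algebra A U]
  [UniformSpace U] [IsUniformAddGroup U] [IsTopologicalRing U] [CompleteSpace U] [T2Space U]

/-- If `Φ` extends `(a ⊗ b, c ⊗ e) ↦ P((a ⊗ c) ⊗ b e g)` and `(z - w) ^ N` kills `P` in its first
two variables, `(x - y) ^ N` kills `∑ Φ((z - w) ^ m, (z - w) ^ n) x ^ (-m-1) y ^ (-n-1)`: in the
three variables `u`, `v`, `w`, multiplication by `x - y` is multiplication by
`(u - w) - (v - w) = u - v`. -/
theorem mulXSubY_iterate_coordDiffZPow_eq_zero {τ τ' : TensorTopology} {z : K}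
    (hd : IsUnit ((coordDiff A τ z : TopTensor A K τ) : Completion (TopTensor A K τ)))
    (hd' : IsUnit ((coordDiff A τ' z : TopTensor A K τ') : Completion (TopTensor A K τ')))
    (g : K) (N : ℕ) (P : (K ⊗[A] K) ⊗[A] K →ₗ[A] U)
    (Φ : Completion (TopTensor A K τ) →+ Completion (TopTensor A K τ') →+ U)
    (hΦ : Continuous fun p : Completion (TopTensor A K τ) × Completion (TopTensor A K τ') =>
      Φ p.1 p.2)
    (hP : ∀ a b c e, Φ (TopTensor.tmul τ a b : TopTensor A K τ)
      (TopTensor.tmul τ' c e : TopTensor A K τ') = P ((a ⊗ₜ c) ⊗ₜ (b * e * g)))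
    (hN : ∀ t h, P (((z ⊗ₜ[A] 1 - 1 ⊗ₜ[A] z) ^ N * t) ⊗ₜ h) = 0) (m n : ℤ) :
    mulXSubY^[N] (fun m n => Φ (coordDiffZPow A τ z m) (coordDiffZPow A τ' z n)) m n = 0 := by
  induction N generalizing P Φ m n with
  | zero =>
    have h0 : Φ = 0 := by
      refine AddMonoidHom.ext fun x => TopTensor.completion_hom_ext
        (hΦ.comp (Continuous.prodMk_right x)) continuous_const fun c e => ?_
      refine DFunLike.congr_fun (f := Φ.flip _) (g := (0 : _ →+ U)) ?_ x
      refine TopTensor.completion_hom_ext (hΦ.comp (Continuous.prodMk_left _)) continuous_const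
        fun a b => ?_
      have := hN (a ⊗ₜ c) (b * e * g)
      rw [pow_zero, one_mul] at this
      rw [AddMonoidHom.flip_apply, hP, this]
      rfl
    simp [h0]
  | succ N ih =>
    rw [Function.iterate_succ_apply]
    set d := ((coordDiff A τ z : TopTensor A K τ) : Completion (TopTensor A K τ)) with hd_def
    set d' := ((coordDiff A τ' z : TopTensor A K τ') : Completion (TopTensor A K τ')) with hd'_def
    set P' := P ∘ₗ TensorProduct.map (LinearMap.mulLeft A (z ⊗ₜ[A] 1 - 1 ⊗ₜ[A] z)) LinearMap.id
    set Φ' := Φ.comp (AddMonoidHom.mulLeft d) - Φ.compl₂ (AddMonoidHom.mulLeft d')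
    have hΦ' : ∀ x y, Φ' x y = Φ (d * x) y - Φ x (d' * y) := fun x y => rfl
    have hstep : mulXSubY (fun m n => Φ (coordDiffZPow A τ z m) (coordDiffZPow A τ' z n)) =
        fun m n => Φ' (coordDiffZPow A τ z m) (coordDiffZPow A τ' z n) := by
      funext m n
      rw [hΦ', ← coordDiffZPow_add_one hd, ← coordDiffZPow_add_one hd']
      rfl
    rw [hstep]
    refine ih P' Φ' ?_ ?_ ?_ m n
    · exact (hΦ.comp ((continuous_const_mul d).prodMap continuous_id)).sub
        (hΦ.comp (continuous_id.prodMap (continuous_const_mul d')))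
    · intro a b c e
      rw [hΦ', hd_def, hd'_def, ← Completion.coe_mul, ← Completion.coe_mul, coordDiff, coordDiff,
        sub_mul, sub_mul]
      simp only [TopTensor.tmul_mul_tmul, Completion.coe_sub, map_sub, AddMonoidHom.sub_apply, hP,
        one_mul, P', LinearMap.comp_apply, TensorProduct.map_tmul, LinearMap.mulLeft_apply, sub_mul,
        Algebra.TensorProduct.tmul_mul_tmul, TensorProduct.sub_tmul, LinearMap.id_apply]
      rw [mul_left_comm b z e, mul_assoc z b e]
      abel
    · intro t h
      simp only [P', LinearMap.comp_apply, TensorProduct.map_tmul, LinearMap.mulLeft_apply,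
        LinearMap.id_apply]
      rw [← mul_assoc, ← pow_succ']
      exact hN t h

variable [IsLinearTopology U U]

/-- If `W(h) = YZ(β (1 ⊗ h)) - (ZY ∘ σ)(β' (1 ⊗ h))`, the distribution
`g ↦ XW(α (1 ⊗ g)) - (WX ∘ σ)(α' (1 ⊗ g))` is the sum of the four triple products
`XYZ - XZY - YZX + ZYX`, each evaluated in the completion in which it converges. -/
theorem prodExt_sub_prodSwapExt_eq {X Y Z W : K →L[A] U} {g : K}
    {α β : Completion (TopTensor A K .right)} {α' β' : Completion (TopTensor A K .left)}
    (hW : ∀ h, W h = prodExt Y Z (β * (TopTensor.tmul .right 1 h : TopTensor A K .right)) -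
      prodSwapExt Y Z (β' * (TopTensor.tmul .left 1 h : TopTensor A K .left)))
    {Φ₁ : Completion (TopTensor A K .right) →+ Completion (TopTensor A K .right) →+ U}
    (c₁ : Continuous fun p : Completion (TopTensor A K .right) ×
      Completion (TopTensor A K .right) => Φ₁ p.1 p.2)
    (h₁ : ∀ a b c e, Φ₁ (TopTensor.tmul .right a b : TopTensor A K .right)
      (TopTensor.tmul .right c e : TopTensor A K .right) = X a * Y c * Z (b * e * g))
    {Φ₂ : Completion (TopTensor A K .right) →+ Completion (TopTensor A K .left) →+ U}
    (c₂ : Continuous fun p : Completion (TopTensor A K .right) ×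
      Completion (TopTensor A K .left) => Φ₂ p.1 p.2)
    (h₂ : ∀ a b c e, Φ₂ (TopTensor.tmul .right a b : TopTensor A K .right)
      (TopTensor.tmul .left c e : TopTensor A K .left) = X a * Z (b * e * g) * Y c)
    {Φ₃ : Completion (TopTensor A K .left) →+ Completion (TopTensor A K .right) →+ U}
    (c₃ : Continuous fun p : Completion (TopTensor A K .left) ×
      Completion (TopTensor A K .right) => Φ₃ p.1 p.2)
    (h₃ : ∀ a b c e, Φ₃ (TopTensor.tmul .left a b : TopTensor A K .left)
      (TopTensor.tmul .right c e : TopTensor A K .right) = Y c * Z (b * e * g) * X a)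
    {Φ₄ : Completion (TopTensor A K .left) →+ Completion (TopTensor A K .left) →+ U}
    (c₄ : Continuous fun p : Completion (TopTensor A K .left) ×
      Completion (TopTensor A K .left) => Φ₄ p.1 p.2)
    (h₄ : ∀ a b c e, Φ₄ (TopTensor.tmul .left a b : TopTensor A K .left)
      (TopTensor.tmul .left c e : TopTensor A K .left) = Z (b * e * g) * (Y c * X a)) :
    prodExt X W (α * (TopTensor.tmul .right 1 g : TopTensor A K .right)) -
      prodSwapExt X W (α' * (TopTensor.tmul .left 1 g : TopTensor A K .left)) =
      Φ₁ α β - Φ₂ α β' - Φ₃ α' β + Φ₄ α' β' := by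
  have e₁ : ∀ a b, X a * prodExt Y Z (β * (TopTensor.tmul .right 1 (b * g) :
      TopTensor A K .right)) = Φ₁ (TopTensor.tmul .right a b : TopTensor A K .right) β :=
    fun a b => by
      refine DFunLike.congr_fun (f := (AddMonoidHom.mulLeft (X a)).comp
        ((prodExt Y Z).comp (AddMonoidHom.mulRight _))) (g := Φ₁ _) ?_ β
      refine TopTensor.completion_hom_ext ((continuous_const_mul _).comp
        ((continuous_prodExt Y Z).comp (continuous_mul_const _)))
        (c₁.comp (Continuous.prodMk_right _)) fun c e => ?_
      simp only [AddMonoidHom.comp_apply, AddMonoidHom.coe_mulLeft, AddMonoidHom.mulRight_apply,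
        ← Completion.coe_mul, TopTensor.tmul_mul_tmul, prodExt_tmul, h₁, mul_one]
      rw [mul_assoc, mul_left_comm e b g, mul_assoc b]
  have e₂ : ∀ a b, X a * prodSwapExt Y Z (β' * (TopTensor.tmul .left 1 (b * g) :
      TopTensor A K .left)) = Φ₂ (TopTensor.tmul .right a b : TopTensor A K .right) β' :=
    fun a b => by
      refine DFunLike.congr_fun (f := (AddMonoidHom.mulLeft (X a)).comp
        ((prodSwapExt Y Z).comp (AddMonoidHom.mulRight _))) (g := Φ₂ _) ?_ β'
      refine TopTensor.completion_hom_ext ((continuous_const_mul _).comp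
        ((continuous_prodSwapExt Y Z).comp (continuous_mul_const _)))
        (c₂.comp (Continuous.prodMk_right _)) fun c e => ?_
      simp only [AddMonoidHom.comp_apply, AddMonoidHom.coe_mulLeft, AddMonoidHom.mulRight_apply,
        ← Completion.coe_mul, TopTensor.tmul_mul_tmul, prodSwapExt_tmul, h₂, mul_one]
      rw [mul_assoc (X a), mul_left_comm e b g, mul_assoc b]
  have e₃ : ∀ a b, prodExt Y Z (β * (TopTensor.tmul .right 1 (b * g) :
      TopTensor A K .right)) * X a = Φ₃ (TopTensor.tmul .left a b : TopTensor A K .left) β :=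
    fun a b => by
      refine DFunLike.congr_fun (f := (AddMonoidHom.mulRight (X a)).comp
        ((prodExt Y Z).comp (AddMonoidHom.mulRight _))) (g := Φ₃ _) ?_ β
      refine TopTensor.completion_hom_ext ((continuous_mul_const _).comp
        ((continuous_prodExt Y Z).comp (continuous_mul_const _)))
        (c₃.comp (Continuous.prodMk_right _)) fun c e => ?_
      simp only [AddMonoidHom.comp_apply, AddMonoidHom.mulRight_apply,
        ← Completion.coe_mul, TopTensor.tmul_mul_tmul, prodExt_tmul, h₃, mul_one]
      rw [mul_left_comm e b g, mul_assoc b]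
  have e₄ : ∀ a b, prodSwapExt Y Z (β' * (TopTensor.tmul .left 1 (b * g) :
      TopTensor A K .left)) * X a = Φ₄ (TopTensor.tmul .left a b : TopTensor A K .left) β' :=
    fun a b => by
      refine DFunLike.congr_fun (f := (AddMonoidHom.mulRight (X a)).comp
        ((prodSwapExt Y Z).comp (AddMonoidHom.mulRight _))) (g := Φ₄ _) ?_ β'
      refine TopTensor.completion_hom_ext ((continuous_mul_const _).comp
        ((continuous_prodSwapExt Y Z).comp (continuous_mul_const _)))
        (c₄.comp (Continuous.prodMk_right _)) fun c e => ?_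
      simp only [AddMonoidHom.comp_apply, AddMonoidHom.mulRight_apply,
        ← Completion.coe_mul, TopTensor.tmul_mul_tmul, prodSwapExt_tmul, h₄, mul_one]
      rw [mul_assoc, mul_left_comm e b g, mul_assoc b]
  have hr : prodExt X W (α * (TopTensor.tmul .right 1 g : TopTensor A K .right)) =
      Φ₁ α β - Φ₂ α β' := by
    refine DFunLike.congr_fun (f := (prodExt X W).comp (AddMonoidHom.mulRight _))
      (g := Φ₁.flip β - Φ₂.flip β') ?_ α
    refine TopTensor.completion_hom_ext ((continuous_prodExt X W).comp (continuous_mul_const _))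
      ((c₁.comp (Continuous.prodMk_left _)).sub (c₂.comp (Continuous.prodMk_left _)))
      fun a b => ?_
    simp only [AddMonoidHom.comp_apply, AddMonoidHom.mulRight_apply, AddMonoidHom.sub_apply,
      AddMonoidHom.flip_apply, ← Completion.coe_mul, TopTensor.tmul_mul_tmul, prodExt_tmul,
      mul_one, hW, mul_sub, e₁, e₂]
  have hl : prodSwapExt X W (α' * (TopTensor.tmul .left 1 g : TopTensor A K .left)) =
      Φ₃ α' β - Φ₄ α' β' := by
    refine DFunLike.congr_fun (f := (prodSwapExt X W).comp (AddMonoidHom.mulRight _))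
      (g := Φ₃.flip β - Φ₄.flip β') ?_ α'
    refine TopTensor.completion_hom_ext
      ((continuous_prodSwapExt X W).comp (continuous_mul_const _))
      ((c₃.comp (Continuous.prodMk_left _)).sub (c₄.comp (Continuous.prodMk_left _)))
      fun a b => ?_
    simp only [AddMonoidHom.comp_apply, AddMonoidHom.mulRight_apply, AddMonoidHom.sub_apply,
      AddMonoidHom.flip_apply, ← Completion.coe_mul, TopTensor.tmul_mul_tmul, prodSwapExt_tmul,
      mul_one, hW, sub_mul, e₃, e₄]
  rw [hr, hl]
  abel

/-- If `(z - w) ^ N [X, Y] = 0`, then `(x - y) ^ N` kills the commutator of the operators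
`∑ X_(m) x ^ (-m-1)` and `∑ Y_(n) y ^ (-n-1)`: the triple products `XZY` and `YZX` cancel, and those
that remain add up to `[X, Y] Z - Z [X, Y]`. -/
theorem nProduct_commutator_locality {z : K}
    (hl : IsUnit ((coordDiff A .left z : TopTensor A K .left) : Completion (TopTensor A K .left)))
    (hr : IsUnit ((coordDiff A .right z : TopTensor A K .right) :
      Completion (TopTensor A K .right))) {X Y : K →L[A] U} {N : ℕ}
    (hN : ∀ t : K ⊗[A] K, bracketDist X.toLinearMap Y.toLinearMap
      ((z ⊗ₜ[A] 1 - 1 ⊗ₜ[A] z) ^ N * t) = 0)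
    (Z : K →L[A] U) (V W : ℤ → K →L[A] U) (hV : ∀ m, (V m).toLinearMap = nProduct z m X Z)
    (hW : ∀ n, (W n).toLinearMap = nProduct z n Y Z) (g : K) (m n : ℤ) :
    mulXSubY^[N] (fun m n => nProduct z m X (W n) g - nProduct z n Y (V m) g) m n = 0 := by
  obtain ⟨Φ₁, c₁, h₁⟩ := exists_tripleExt_right_right
    (prodDist X.toLinearMap Y.toLinearMap) Z g
  obtain ⟨Ψ₁, d₁, k₁⟩ := exists_tripleExt_right_right
    (prodDistSwap X.toLinearMap Y.toLinearMap) Z g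
  obtain ⟨Φ₂, c₂, h₂⟩ := exists_tripleExt_right_left X Z Y g
  obtain ⟨Φ₃, c₃, h₃⟩ := exists_tripleExt_left_right Y Z X g
  have hQ : Continuous fun p : K × K => prodDist X.toLinearMap Y.toLinearMap (p.1 ⊗ₜ p.2) := by
    change Continuous fun p : K × K => X p.1 * Y p.2
    fun_prop
  have hQ' : Continuous fun p : K × K =>
      prodDistSwap X.toLinearMap Y.toLinearMap (p.1 ⊗ₜ p.2) := by
    change Continuous fun p : K × K => Y p.2 * X p.1
    fun_prop
  obtain ⟨Φ₄, c₄, h₄⟩ := exists_tripleExt_left_left _ hQ' Z g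
  obtain ⟨Ψ₄, d₄, k₄⟩ := exists_tripleExt_left_left _ hQ Z g
  have hXW : ∀ m n, nProduct z m X (W n) g =
      Φ₁ (coordDiffZPow A .right z m) (coordDiffZPow A .right z n) -
      Φ₂ (coordDiffZPow A .right z m) (coordDiffZPow A .left z n) -
      Φ₃ (coordDiffZPow A .left z m) (coordDiffZPow A .right z n) +
      Φ₄ (coordDiffZPow A .left z m) (coordDiffZPow A .left z n) := fun m n =>
    prodExt_sub_prodSwapExt_eq (fun h => DFunLike.congr_fun (hW n) h) c₁ h₁ c₂ h₂ c₃ h₃ c₄ h₄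
  -- With `X` and `Y` exchanged, the terms `YXZ`, `YZX`, `XZY`, `ZXY` arise from the same products,
  -- the two variables being exchanged.
  have hYV : ∀ m n, nProduct z n Y (V m) g =
      Ψ₁ (coordDiffZPow A .right z m) (coordDiffZPow A .right z n) -
      Φ₃ (coordDiffZPow A .left z m) (coordDiffZPow A .right z n) -
      Φ₂ (coordDiffZPow A .right z m) (coordDiffZPow A .left z n) +
      Ψ₄ (coordDiffZPow A .left z m) (coordDiffZPow A .left z n) := fun m n =>
    prodExt_sub_prodSwapExt_eq (Φ₁ := Ψ₁.flip) (Φ₂ := Φ₃.flip) (Φ₃ := Φ₂.flip) (Φ₄ := Ψ₄.flip)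
      (fun h => DFunLike.congr_fun (hV m) h)
      (d₁.comp continuous_swap) (fun a b c e => by
        rw [AddMonoidHom.flip_apply, k₁, mul_comm e b]; rfl)
      (c₃.comp continuous_swap) (fun a b c e => by
        rw [AddMonoidHom.flip_apply, h₃, mul_comm e b])
      (c₂.comp continuous_swap) (fun a b c e => by
        rw [AddMonoidHom.flip_apply, h₂, mul_comm e b])
      (d₄.comp continuous_swap) (fun a b c e => by
        rw [AddMonoidHom.flip_apply, k₄, mul_comm e b]; rfl)
  have hsum : (fun m n => nProduct z m X (W n) g - nProduct z n Y (V m) g) =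
      (fun m n => (Φ₁ - Ψ₁) (coordDiffZPow A .right z m) (coordDiffZPow A .right z n)) +
      fun m n => (Φ₄ - Ψ₄) (coordDiffZPow A .left z m) (coordDiffZPow A .left z n) := by
    funext m n
    simp only [hXW, hYV, Pi.add_apply, AddMonoidHom.sub_apply]
    abel
  have hright := mulXSubY_iterate_coordDiffZPow_eq_zero hr hr g N
    (LinearMap.mul' A U ∘ₗ
      TensorProduct.map (bracketDist X.toLinearMap Y.toLinearMap) Z.toLinearMap) (Φ₁ - Ψ₁)
    (c₁.sub d₁) (fun a b c e => by
      simp [h₁, k₁, bracketDist, sub_mul])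
    (fun t h => by simp [hN]) m n
  have hleft := mulXSubY_iterate_coordDiffZPow_eq_zero hl hl g N
    (-(LinearMap.mul' A U ∘ₗ
      TensorProduct.map Z.toLinearMap (bracketDist X.toLinearMap Y.toLinearMap) ∘ₗ
        (TensorProduct.comm A (K ⊗[A] K) K).toLinearMap)) (Φ₄ - Ψ₄)
    (c₄.sub d₄) (fun a b c e => by
      simp [h₄, k₄, bracketDist, mul_sub])
    (fun t h => by simp [hN]) m n
  rw [hsum, mulXSubY_iterate_add, Pi.add_apply, Pi.add_apply, hright, hleft, add_zero]

end Locality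

/-! ### The unit field -/

section Unit

variable {A K U : Type*} [CommRing A] [CommRing K] [Algebra A K] [TopologicalSpace K]
  [IsTopologicalRing K] [IsLinearTopology A K] [Ring U] [Algebra A U]
  [UniformSpace U] [IsUniformAddGroup U] [IsTopologicalRing U] [CompleteSpace U] [T2Space U]
  [IsLinearTopology U U] [Algebra ℂ U] [SMulCommClass A ℂ U] {z : K}

theorem fieldDeriv_add (X Y : K →L[A] U) :
    fieldDeriv z (X + Y) = fieldDeriv z X + fieldDeriv z Y := by
  ext g
  simp only [fieldDeriv_apply, add_apply, neg_add]

theorem fieldDeriv_smul (c : ℂ) (X : K →L[A] U) : fieldDeriv z (c • X) = c • fieldDeriv z X := by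
  ext g
  simp only [fieldDeriv_apply, smul_apply, smul_neg]

/-- The translation property, when `X_(n) Y` is a field `W`. -/
theorem toLinearMap_fieldDeriv_sub_nProduct
    (hl : IsUnit ((coordDiff A .left z : TopTensor A K .left) : Completion (TopTensor A K .left)))
    (hr : IsUnit ((coordDiff A .right z : TopTensor A K .right) :
      Completion (TopTensor A K .right)))
    (hz : coordDeriv A z z = 1) {X Y W : K →L[A] U} {n : ℤ}
    (hW : W.toLinearMap = nProduct z n X Y) :
    (fieldDeriv z W).toLinearMap - nProduct z n X (fieldDeriv z Y) =
      (-n : ℂ) • nProduct z (n - 1) X Y := by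
  ext g
  have h := nProduct_translation hl hr hz X Y n g
  have hWg : ∀ x, W x = nProduct z n X Y x := fun x => DFunLike.congr_fun hW x
  rw [LinearMap.sub_apply, ContinuousLinearMap.coe_coe, fieldDeriv_apply, hWg, h,
    LinearMap.smul_apply, ← Int.cast_neg, Int.cast_smul_eq_zsmul]

/-- A central field `vac` with `vac_(-1) X = X` for all `X` in a `∂`-stable space satisfies
`vac_(n) X = 0` for all `n ≠ -1`: for `n ≥ 0` since `vac` commutes with `X`, for `n ≤ -2` by the
translation property and descending induction. -/
theorem nProduct_unit_left
    (hl : IsUnit ((coordDiff A .left z : TopTensor A K .left) : Completion (TopTensor A K .left)))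
    (hr : IsUnit ((coordDiff A .right z : TopTensor A K .right) :
      Completion (TopTensor A K .right)))
    (hz : coordDeriv A z z = 1) {V : Submodule ℂ (K →L[A] U)} {vac : K →L[A] U}
    (hV : ∀ X ∈ V, fieldDeriv z X ∈ V) (hcentral : ∀ g, vac g ∈ Subring.center U)
    (hunit : ∀ X ∈ V, nProduct z (-1) vac X = X.toLinearMap) {X : K →L[A] U} (hX : X ∈ V)
    {n : ℤ} (hn : n ≠ -1) : nProduct z n vac X = 0 := by
  rcases le_or_gt 0 n with h0 | h0
  · lift n to ℕ using h0
    refine nProduct_natCast_eq_zero (N := 0) (fun t => ?_) n.zero_le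
    rw [bracketDist_eq_zero_of_commute fun a b => ((Subring.mem_center_iff.1 (hcentral a)) _).symm]
    rfl
  · obtain ⟨k, rfl⟩ : ∃ k : ℕ, n = -(k : ℤ) - 2 := ⟨(-n - 2).toNat, by omega⟩
    clear hn h0
    induction k generalizing X with
    | zero =>
      have h := toLinearMap_fieldDeriv_sub_nProduct hl hr hz (hunit X hX).symm
      rw [hunit _ (hV X hX), sub_self] at h
      simpa using h.symm
    | succ k ih =>
      have h := toLinearMap_fieldDeriv_sub_nProduct hl hr hz (W := 0) (ih hX).symm
      have h0 : fieldDeriv z (0 : K →L[A] U) = 0 := by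
        ext g
        simp [fieldDeriv_apply]
      rw [ih (hV X hX), h0, sub_zero] at h
      have hk : (-((-(k : ℤ) - 2 : ℤ) : ℂ)) ≠ 0 := by
        rw [← Int.cast_neg]
        exact Int.cast_ne_zero.2 (by omega)
      have h' := (smul_eq_zero_iff_right hk).1 h.symm
      convert h' using 2
      push_cast
      ring

/-- If `vac` is annihilated by `∂`, commutes with `X` and satisfies `X_(-1) vac = X`, then each
`X_(n) vac` is zero or a multiple of a derivative of `X`. -/
theorem exists_nProduct_unit_right
    (hl : IsUnit ((coordDiff A .left z : TopTensor A K .left) : Completion (TopTensor A K .left)))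
    (hr : IsUnit ((coordDiff A .right z : TopTensor A K .right) :
      Completion (TopTensor A K .right)))
    (hz : coordDeriv A z z = 1) {V : Submodule ℂ (K →L[A] U)} {vac : K →L[A] U}
    (hV : ∀ X ∈ V, fieldDeriv z X ∈ V) (hderiv : fieldDeriv z vac = 0) {X : K →L[A] U}
    (hX : X ∈ V) (hunit : nProduct z (-1) X vac = X.toLinearMap)
    (hcomm : bracketDist X.toLinearMap vac.toLinearMap = 0) (n : ℤ) :
    ∃ W ∈ V, W.toLinearMap = nProduct z n X vac := by
  rcases le_or_gt 0 n with h0 | h0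
  · lift n to ℕ using h0
    refine ⟨0, V.zero_mem, ?_⟩
    rw [nProduct_natCast_eq_zero (N := 0) (fun t => by rw [hcomm]; rfl) n.zero_le]
    rfl
  · obtain ⟨k, rfl⟩ : ∃ k : ℕ, n = -(k : ℤ) - 1 := ⟨(-n - 1).toNat, by omega⟩
    clear h0
    induction k with
    | zero => exact ⟨X, hX, by simpa using hunit.symm⟩
    | succ k ih =>
      obtain ⟨W, hWV, hW⟩ := ih
      have h := toLinearMap_fieldDeriv_sub_nProduct hl hr hz hW
      have h0 : nProduct z (-(k : ℤ) - 1) X 0 = 0 := by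
        have := nProduct_add_right z (-(k : ℤ) - 1) X 0 0
        rwa [add_zero, left_eq_add] at this
      rw [hderiv, h0, sub_zero] at h
      have hk : (-((-(k : ℤ) - 1 : ℤ) : ℂ)) ≠ 0 := by
        rw [← Int.cast_neg]
        exact Int.cast_ne_zero.2 (by omega)
      refine ⟨(-((-(k : ℤ) - 1 : ℤ) : ℂ))⁻¹ • fieldDeriv z W, V.smul_mem _ (hV W hWV), ?_⟩
      rw [ContinuousLinearMap.toLinearMap_smul, h, smul_smul, inv_mul_cancel₀ hk, one_smul]
      congr 1
      push_cast
      ring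

end Unit

/-! ### The vertex algebra -/

section VertexAlgebra

/-- A vertex algebra structure is determined by its vacuum, its translation operator and the
bilinear products `a_(n) b`. -/
theorem VertexAlgebraStructure.exists_of_products {V : Type*} [AddCommGroup V] [Module ℂ V]
    (op : ℤ → V →ₗ[ℂ] V →ₗ[ℂ] V) (T : V →ₗ[ℂ] V) (vac : V)
    (hbdd : ∀ a b, ∃ N : ℕ, ∀ n : ℕ, N ≤ n → op n a b = 0)
    (hleft : ∀ a, op (-1) vac a = a) (hleft' : ∀ n a, n ≠ -1 → op n vac a = 0)
    (hright : ∀ a, op (-1) a vac = a) (hright' : ∀ n a, 0 ≤ n → op n a vac = 0)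
    (hT : T vac = 0)
    (htrans : ∀ a b n, T (op n a b) - op n a (T b) = (-n : ℂ) • op (n - 1) a b)
    (hlocal : ∀ a b, ∃ N : ℕ, ∀ c m n,
      mulXSubY^[N] (fun m n => op m a (op n b c) - op n b (op m a c)) m n = 0) :
    ∃ 𝒱 : VertexAlgebraStructure V, 𝒱.vacuum = vac ∧ 𝒱.T = T ∧
      ∀ a n, (𝒱.Y a).ncoeff n = op n a := by
  -- The coefficient of index `k` is that of `x ^ k`, that is, `a_(-k-1)`.
  have hbdd' : ∀ a b, BddBelow (Function.support fun k : ℤ => op (-k - 1) a b) := fun a b => by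
    obtain ⟨N, hN⟩ := hbdd a b
    refine ⟨-N - 1, fun k hk => ?_⟩
    by_contra hlt
    obtain ⟨j, hj⟩ : ∃ j : ℕ, -k - 1 = j := ⟨(-k - 1).toNat, by omega⟩
    exact hk (show op (-k - 1) a b = 0 by rw [hj, hN j (by omega)])
  obtain ⟨𝒴, h𝒴⟩ : ∃ 𝒴 : V →ₗ[ℂ] VertexOperator ℂ V, ∀ a n, (𝒴 a).ncoeff n = op n a := by
    refine ⟨
      { toFun := fun a => VertexOperator.of_coeff (fun k => op (-k - 1) a) (hbdd' a)
        map_add' := fun a a' => HVertexOperator.coeff_inj ?_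
        map_smul' := fun c a => HVertexOperator.coeff_inj ?_ }, fun a n => ?_⟩
    · exact funext fun k => map_add (op (-k - 1)) a a'
    · exact funext fun k => map_smul (op (-k - 1)) c a
    · refine (VertexOperator.ncoeff_of_coeff _ (hbdd' a) n).trans ?_
      exact congrArg (fun k => op k a) (by ring : -(-n - 1) - 1 = n)
  refine ⟨
    { vacuum := vac
      T := T
      Y := 𝒴
      vacuum_left := fun n a => ?_
      vacuum_right_nonneg := fun a n hn => by rw [h𝒴, hright' n a hn]
      vacuum_right := fun a => by rw [h𝒴, hright]
      T_vacuum := hT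
      translation := fun a b n => by rw [h𝒴, h𝒴, htrans]
      locality := fun a b => ?_ }, rfl, rfl, h𝒴⟩
  · rw [h𝒴]
    split_ifs with hn
    · rw [hn, hleft]
    · exact hleft' n a hn
  · obtain ⟨N, hN⟩ := hlocal a b
    refine ⟨N, funext fun m => funext fun n => LinearMap.ext fun c => ?_⟩
    let ev : Module.End ℂ V →+ V := (LinearMap.applyₗ c).toAddMonoidHom
    have hev := map_mulXSubY_iterate ev N (fun m n => ⁅(𝒴 a).ncoeff m, (𝒴 b).ncoeff n⁆) m n
    have hfun : (fun m n => ev ⁅(𝒴 a).ncoeff m, (𝒴 b).ncoeff n⁆) =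
        fun m n => op m a (op n b c) - op n b (op m a c) := by
      funext m n
      rw [h𝒴, h𝒴]
      rfl
    rw [hfun] at hev
    exact hev.trans (hN c m n)

variable {A K U : Type*} [CommRing A] [CommRing K] [Algebra A K] [TopologicalSpace K]
  [IsTopologicalRing K] [IsLinearTopology A K] [Ring U] [Algebra A U]
  [UniformSpace U] [IsUniformAddGroup U] [IsTopologicalRing U] [CompleteSpace U] [T2Space U]
  [IsLinearTopology U U] [Algebra ℂ U] [SMulCommClass A ℂ U] {z : K}

/-- The `n`-product of a closed space of fields, as a bilinear map. -/
theorem exists_bilinear_nProduct {V : Submodule ℂ (K →L[A] U)} (hV : IsClosedSpace z V) (n : ℤ) :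
    ∃ op : V →ₗ[ℂ] V →ₗ[ℂ] V,
      ∀ X Y, (op X Y : K →L[A] U).toLinearMap = nProduct z n (X : K →L[A] U) Y := by
  choose f hfV hf using fun X Y : V => hV.1 X X.2 Y Y.2 n
  have hinj : ∀ {X Y : V}, X.1.toLinearMap = Y.1.toLinearMap → X = Y := fun h =>
    Subtype.ext (ContinuousLinearMap.coe_injective h)
  refine ⟨LinearMap.mk₂ ℂ (fun X Y => ⟨f X Y, hfV X Y⟩) (fun X X' Y => hinj ?_)
    (fun c X Y => hinj ?_) (fun X Y Y' => hinj ?_) (fun c X Y => hinj ?_), hf⟩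
  · exact (hf _ _).trans ((nProduct_add_left z n X.1 X'.1 Y.1).trans
      (congrArg₂ (· + ·) (hf X Y) (hf X' Y)).symm)
  · exact (hf _ _).trans ((nProduct_smul_left z n c X.1 Y.1).trans
      (congrArg (c • ·) (hf X Y)).symm)
  · exact (hf _ _).trans ((nProduct_add_right z n X.1 Y.1 Y'.1).trans
      (congrArg₂ (· + ·) (hf X Y) (hf X Y')).symm)
  · exact (hf _ _).trans ((nProduct_smul_right z n c X.1 Y.1).trans
      (congrArg (c • ·) (hf X Y)).symm)

/-- A closed space of mutually local fields, with a unit `vac` for the `n`-products, is a vertex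
algebra. -/
theorem exists_vertexAlgebraStructure
    (hl : IsUnit ((coordDiff A .left z : TopTensor A K .left) : Completion (TopTensor A K .left)))
    (hr : IsUnit ((coordDiff A .right z : TopTensor A K .right) :
      Completion (TopTensor A K .right)))
    (hz : coordDeriv A z z = 1) {V : Submodule ℂ (K →L[A] U)} (hV : IsClosedSpace z V)
    (hlocal : ∀ X ∈ V, ∀ Y ∈ V, MutuallyLocal z X.toLinearMap Y.toLinearMap)
    {vac : K →L[A] U} (hvac : vac ∈ V) (hderiv : fieldDeriv z vac = 0)
    (hleft : ∀ X ∈ V, nProduct z (-1) vac X = X.toLinearMap)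
    (hleft' : ∀ X ∈ V, ∀ n : ℤ, n ≠ -1 → nProduct z n vac X = 0)
    (hright : ∀ X ∈ V, nProduct z (-1) X vac = X.toLinearMap)
    (hright' : ∀ X ∈ V, ∀ n : ℤ, 0 ≤ n → nProduct z n X vac = 0) :
    ∃ 𝒱 : VertexAlgebraStructure V, (𝒱.vacuum : K →L[A] U) = vac ∧
      (∀ X, (𝒱.T X : K →L[A] U) = fieldDeriv z (X : K →L[A] U)) ∧
      ∀ (X Y) (n : ℤ), (((𝒱.Y X).ncoeff n Y : V) : K →L[A] U).toLinearMap =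
        nProduct z n X Y := by
  have hinj : ∀ {X Y : V}, X.1.toLinearMap = Y.1.toLinearMap → X = Y := fun h =>
    Subtype.ext (ContinuousLinearMap.coe_injective h)
  choose op hop using exists_bilinear_nProduct hV
  obtain ⟨T, hT⟩ : ∃ T : V →ₗ[ℂ] V, ∀ X, (T X : K →L[A] U) = fieldDeriv z X :=
    ⟨{ toFun := fun X => ⟨fieldDeriv z X.1, hV.2 _ X.2⟩
       map_add' := fun X Y => Subtype.ext (fieldDeriv_add _ _)
       map_smul' := fun c X => Subtype.ext (fieldDeriv_smul _ _) }, fun X => rfl⟩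
  obtain ⟨v, hv⟩ : ∃ v : V, v.1 = vac := ⟨⟨vac, hvac⟩, rfl⟩
  subst hv
  have h1 : ∀ X Y, ∃ N : ℕ, ∀ n : ℕ, N ≤ n → op n X Y = 0 := fun X Y => by
    obtain ⟨N, hN⟩ := hlocal X X.2 Y Y.2
    exact ⟨N, fun n hn => hinj ((hop n X Y).trans (nProduct_natCast_eq_zero hN hn))⟩
  have h2 : ∀ X, op (-1) v X = X := fun X => hinj ((hop _ _ _).trans (hleft X X.2))
  have h3 : ∀ (n : ℤ) X, n ≠ -1 → op n v X = 0 := fun n X hn =>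
    hinj ((hop _ _ _).trans (hleft' X X.2 n hn))
  have h4 : ∀ X, op (-1) X v = X := fun X => hinj ((hop _ _ _).trans (hright X X.2))
  have h5 : ∀ (n : ℤ) X, 0 ≤ n → op n X v = 0 := fun n X hn =>
    hinj ((hop _ _ _).trans (hright' X X.2 n hn))
  have h6 : T v = 0 := Subtype.ext ((hT _).trans hderiv)
  have h7 : ∀ X Y (n : ℤ), T (op n X Y) - op n X (T Y) = (-n : ℂ) • op (n - 1) X Y :=
    fun X Y n => hinj (by
      change (T (op n X Y)).1.toLinearMap - (op n X (T Y)).1.toLinearMap =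
        (-n : ℂ) • (op (n - 1) X Y).1.toLinearMap
      rw [hop, hop, hT, hT]
      exact toLinearMap_fieldDeriv_sub_nProduct hl hr hz (hop n X Y))
  have h8 : ∀ X Y, ∃ N : ℕ, ∀ Z m n,
      mulXSubY^[N] (fun m n => op m X (op n Y Z) - op n Y (op m X Z)) m n = 0 := fun X Y => by
    obtain ⟨N, hN⟩ := hlocal X X.2 Y Y.2
    refine ⟨N, fun Z m n => hinj (LinearMap.ext fun g => ?_)⟩
    let ev : V →+ U :=
      { toFun := fun W => W.1 g
        map_zero' := rfl
        map_add' := fun _ _ => rfl }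
    have hev := map_mulXSubY_iterate ev N
      (fun m n => op m X (op n Y Z) - op n Y (op m X Z)) m n
    have hloc := nProduct_commutator_locality hl hr hN Z.1 (fun m => (op m X Z).1)
      (fun n => (op n Y Z).1) (fun m => hop m X Z) (fun n => hop n Y Z) g m n
    have hfun : (fun m n => ev (op m X (op n Y Z) - op n Y (op m X Z))) = fun m n =>
        nProduct z m X.1 (op n Y Z).1 g - nProduct z n Y.1 (op m X Z).1 g := by
      funext m n
      rw [← hop, ← hop]
      rfl
    rw [hfun] at hev
    exact hev.trans hloc
  obtain ⟨𝒱, h𝒱vac, h𝒱T, h𝒱Y⟩ :=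
    VertexAlgebraStructure.exists_of_products op T v h1 h2 h3 h4 h5 h6 h7 h8
  refine ⟨𝒱, by rw [h𝒱vac], fun X => by rw [h𝒱T, hT], fun X Y n => ?_⟩
  rw [h𝒱Y, hop]

end VertexAlgebra

theorem mainTheorem5 {A R K U : Type*}
    [CommRing A] [Algebra ℂ A] [IsNoetherianRing A]
    [CommRing R] [Algebra A R] [UniformSpace R] [IsUniformAddGroup R] [IsTopologicalRing R]
    [IsLinearTopology A R] [CompleteSpace R] [T2Space R]
    [CommRing K] [Algebra A K] [Algebra R K] [IsScalarTower A R K]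
    [TopologicalSpace K] [IsTopologicalRing K] [IsLinearTopology A K]
    [Ring U] [Algebra A U] [Algebra ℂ U] [IsScalarTower ℂ A U]
    [UniformSpace U] [IsUniformAddGroup U] [IsTopologicalRing U]
    [CompleteSpace U] [T2Space U] [IsLinearTopology U U]
    (φ : R) (hR : IsPhiAdicRing A φ) (hK : IsPhiLocalization K φ)
    (z : R) (hz : IsGlobalCoordinate A z)
    (F : Submodule ℂ (K →L[A] U))
    (hF_closed : IsClosedSpace (algebraMap R K z) F)
    (hF_local : ∀ X ∈ F, ∀ Y ∈ F,
      MutuallyLocal (algebraMap R K z) X.toLinearMap Y.toLinearMap)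
    (vac : K →L[A] U)
    (hvac_central : ∀ g : K, vac g ∈ Subring.center U)
    (hvac_deriv : fieldDeriv (algebraMap R K z) vac = 0)
    (hvac_unit : ∀ X ∈ F ⊔ Submodule.span ℂ {vac},
      nProduct (algebraMap R K z) (-1) vac X = X.toLinearMap) :
    ∃ 𝒱 : VertexAlgebraStructure ↥(F ⊔ Submodule.span ℂ {vac}),
      (𝒱.vacuum : K →L[A] U) = vac ∧
      (∀ X, (𝒱.T X : K →L[A] U) = fieldDeriv (algebraMap R K z) (X : K →L[A] U)) ∧
      ∀ (X Y) (n : ℤ),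
        (((𝒱.Y X).ncoeff n Y : ↥(F ⊔ Submodule.span ℂ {vac})) : K →L[A] U).toLinearMap =
          nProduct (algebraMap R K z) n X Y := by
  set ζ := algebraMap R K z with hζ
  set V := F ⊔ Submodule.span ℂ {vac} with hV
  have hl := hK.isUnit_coordDiff_left hR hz
  have hr := hK.isUnit_coordDiff_right hR hz
  have hd := hK.coordDeriv_apply_self hR hz
  have hdiag := hK.diagonalSubring_eq_top hR hz
  have hcomm : ∀ (g : K) (u : U), vac g * u = u * vac g := fun g u =>
    (Subring.mem_center_iff.1 (hvac_central g) u).symm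
  have hvacV : vac ∈ V := Submodule.mem_sup_right (Submodule.mem_span_singleton_self vac)
  have hdecomp : ∀ X ∈ V, ∃ X₀ ∈ F, ∃ c : ℂ, X = X₀ + c • vac := fun X hX => by
    obtain ⟨X₀, hX₀, Y, hY, rfl⟩ := Submodule.mem_sup.1 hX
    obtain ⟨c, rfl⟩ := Submodule.mem_span_singleton.1 hY
    exact ⟨X₀, hX₀, c, rfl⟩
  have hderiv : ∀ X ∈ V, fieldDeriv ζ X ∈ V := fun X hX => by
    obtain ⟨X₀, hX₀, c, rfl⟩ := hdecomp X hX
    have h0 : c • (0 : K →L[A] U) = 0 := by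
      ext g
      simp
    rw [fieldDeriv_add, fieldDeriv_smul, hvac_deriv, h0, add_zero]
    exact Submodule.mem_sup_left (hF_closed.2 X₀ hX₀)
  have hleft' : ∀ X ∈ V, ∀ n : ℤ, n ≠ -1 → nProduct ζ n vac X = 0 := fun X hX n hn =>
    nProduct_unit_left hl hr hd hderiv hvac_central hvac_unit hX hn
  have hbracket : ∀ X : K →L[A] U, bracketDist X.toLinearMap vac.toLinearMap = 0 := fun X =>
    bracketDist_eq_zero_of_commute fun a b => (hcomm b (X a)).symm
  have hright : ∀ X ∈ V, nProduct ζ (-1) X vac = X.toLinearMap := fun X hX => by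
    rw [nProduct_neg_one_comm hl hr hdiag (hbracket X), hvac_unit X hX]
  refine exists_vertexAlgebraStructure hl hr hd ⟨?_, hderiv⟩ ?_ hvacV hvac_deriv hvac_unit
    hleft' hright ?_
  · intro X hX Y hY n
    obtain ⟨X₀, hX₀, c, rfl⟩ := hdecomp X hX
    obtain ⟨Y₀, hY₀, c', rfl⟩ := hdecomp Y hY
    have hX₀V : X₀ ∈ V := Submodule.mem_sup_left hX₀
    obtain ⟨W₁, hW₁, h₁⟩ := hF_closed.1 X₀ hX₀ Y₀ hY₀ n
    obtain ⟨W₂, hW₂, h₂⟩ := exists_nProduct_unit_right hl hr hd hderiv hvac_deriv hX₀V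
      (hright X₀ hX₀V) (hbracket X₀) n
    obtain ⟨W₃, hW₃, h₃⟩ : ∃ W ∈ V, W.toLinearMap = nProduct ζ n vac (Y₀ + c' • vac) := by
      by_cases hn : n = -1
      · exact ⟨_, hY, by rw [hn, hvac_unit _ hY]⟩
      · exact ⟨0, V.zero_mem, by rw [hleft' _ hY n hn]; rfl⟩
    refine ⟨W₁ + c' • W₂ + c • W₃, V.add_mem (V.add_mem (Submodule.mem_sup_left hW₁)
      (V.smul_mem _ hW₂)) (V.smul_mem _ hW₃), ?_⟩
    rw [nProduct_add_left, nProduct_smul_left, ← h₃, nProduct_add_right, nProduct_smul_right,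
      ← h₁, ← h₂]
    rfl
  · intro X hX Y hY
    obtain ⟨X₀, hX₀, c, rfl⟩ := hdecomp X hX
    obtain ⟨Y₀, hY₀, c', rfl⟩ := hdecomp Y hY
    obtain ⟨N, hN⟩ := hF_local X₀ hX₀ Y₀ hY₀
    have h : bracketDist (X₀ + c • vac).toLinearMap (Y₀ + c' • vac).toLinearMap =
        bracketDist X₀.toLinearMap Y₀.toLinearMap := by
      ext a b
      simp only [bracketDist, prodDistSwap, prodDist, LinearMap.comp_apply, LinearMap.sub_apply,
        TensorProduct.AlgebraTensorModule.curry_apply, LinearMap.restrictScalars_self,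
        TensorProduct.curry_apply, TensorProduct.map_tmul, LinearMap.mul'_apply,
        LinearEquiv.coe_coe, TensorProduct.comm_tmul, ContinuousLinearMap.coe_coe, add_apply,
        smul_apply, mul_add, add_mul, smul_mul_assoc, mul_smul_comm, smul_add]
      rw [hcomm a (Y₀ b), hcomm b (X₀ a), hcomm a (vac b), smul_comm c c']
      abel
    exact ⟨N, fun t => by rw [h]; exact hN t⟩
  · intro X _ n hn
    lift n to ℕ using hn
    exact nProduct_natCast_eq_zero (N := 0) (fun t => by rw [hbracket]; rfl) n.zero_le
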